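/- **Setting.** Rows $i\in[m]$, columns $j\in[n]$, treatment levels $\mathcal L=\{1,\dots,l\}$, potential outcomes $Y_{ij}^{(d)}$, assignment $D_{ij}\in\{0\}\cup\mathcal L$ ($0$ = unobserved); for $D_{ij}\neq 0$ one observes $\tilde Y_{ij}=Y_{ij}^{(D_{ij})}$. All expectations and probabilities are conditional on the latent factors and the assignment, $\mathcal E=\{U,V,D\}$; the remaining randomness is the noise. Put $A_{ij}^{(d)}=\mathbb E[Y_{ij}^{(d)}]$. Fix a target $(i,j,d)$. **Subgroups.** For $k\in[K]$, $K=K_{\rm MSNN}\ge 1$, let $\mathrm{MAR}^{(k)}\subseteq[m]\setminus\{i\}$ and $\mathrm{MAC}^{(k)}\subseteq[n]\setminus\{j\}$ be such that $D_{ab}=D_{ib}=:d(b)\neq0$ and $D_{aj}=d$ for all $a\in\mathrm{MAR}^{(k)}$, $b\in\mathrm{MAC}^{(k)}$, the sets $\mathrm{MAR}^{(k)}$ being mutually disjoint. **Estimator.** With weights $w(b,e)=1/f(e)$ let $S^{(k)}_w=[w(b,d(b))\tilde Y_{ab}]_{a\in \mathrm{MAR}^{(k)},\,b\in\mathrm{MAC}^{(k)}}$,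 $q^{(k)}_w=[w(b,d(b))\tilde Y_{ib}]_{b\in\mathrm{MAC}^{(k)}}$, $x^{(k)}=[\tilde Y_{aj}]_{a\in\mathrm{MAR}^{(k)}}$ and $r^{(k)}=\operatorname{rank}\mathbb E[S_w^{(k)}]$. For a singular value decomposition $S_w^{(k)}=\sum_l\hat\tau_l\,\hat u_l\otimes\hat v_l$ (decreasing singular values; any choice, with $1/0:=0$) let $\hat\beta^{(k)}=\sum_{l\le r^{(k)}}\hat\tau_l^{-1}\langle\hat v_l,q_w^{(k)}\rangle\hat u_l$, and $\hat A_{ij}^{(d)}=\frac1K\sum_{k}\langle x^{(k)},\hat\beta^{(k)}\rangle$. **Assumptions,** with universal constants $\mu\in\mathbb N$ and $\sigma,C,c,c'>0$: 1. $Y_{ij}^{(d)}=\langle u_i^{(d)},v_j^{(d)}\rangle+\epsilon_{ij}^{(d)}$ with $u_i^{(d)},v_j^{(d)}\in\mathbb R^r$. 2. $\mathbb E[\epsilon_{ij}^{(d)}]=0$. 3. For every row $i'$, every level $e$ and every $I\subseteq[m]\setminus\{i'\}$ with $|I|\ge\mu$, $u_{i'}^{(e)}$ is a linear combination of $(u_a^{(e)})_{a\in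 I}$. 4. $u_i^{(d)}=u_i$ does not depend on $d$. 5. $|A_{ij}^{(d)}|\le f(d)$, where $f>0$. 6. The $\epsilon_{ij}^{(d)}$ are independent, mean-zero, sub-gaussian, with $\mathbb E[(\epsilon_{ij}^{(d)})^2]=(\sigma_{ij}^{(d)})^2$, $\|\epsilon_{ij}^{(d)}\|_{\psi_2}\le C\sigma_{ij}^{(d)}$ and $0\le\sigma_{ij}^{(d)}\le\sigma f(d)$. 7. For each $k$, the non-zero singular values $\tau_1\ge\dots\ge\tau_{r^{(k)}}$ of $\mathbb E[S_w^{(k)}]$ satisfy $\tau_{r^{(k)}}\ge c\,\tau_1$ and $\sum_l\tau_l^2=\|\mathbb E[S_w^{(k)}]\|_F^2\ge c'\,|\mathrm{MAR}^{(k)}||\mathrm{MAC}^{(k)}|$. 8. For each $k$, $\mathbb E[x^{(k)}]$ lies in the column space of $\mathbb E[S_w^{(k)}]$. **Theorem 4.3 (finite-sample error bound).** Consider a sequence of such problems satisfying Assumptions 1–8 with the same universal constants (all other data may vary along the sequence), with $|\mathrm{MAR}^{(k)}|\ge\mu$ for all $k\in[K]$ and $K=o\big(\min_k|\mathrm{MAC}^{(k)}|^{10}|\mathrm{MAR}^{(k)}|^{10}\big)$.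 Let $\beta^{(k)}\in\mathbb R^{\mathrm{MAR}^{(k)}}$ be any vector with $u_i=\sum_{a\in\mathrm{MAR}^{(k)}}\beta^{(k)}_au_a$, and $\tilde\beta^{(k)}$ its orthogonal projection onto the column space of $\mathbb E[S_w^{(k)}]$. Then $$\hat A_{ij}^{(d)}-A_{ij}^{(d)}=f(d)\cdot O_p\Big(\frac1K\Big\{\sum_{k=1}^K(\mathrm{error}_{k,1}+\mathrm{error}_{k,2})+\Big[\sum_{k=1}^K\|\tilde\beta^{(k)}\|_2^2\Big]^{1/2}\Big\}\Big),$$ $$\mathrm{error}_{k,1}=\frac{(r^{(k)})^{1/2}}{|\mathrm{MAC}^{(k)}|^{1/4}},\qquad \mathrm{error}_{k,2}=\frac{(r^{(k)})^{3/2}\,\|\tilde\beta^{(k)}\|_1\,\log^{1/2}\!\big(|\mathrm{MAC}^{(k)}||\mathrm{MAR}^{(k)}|\big)}{\min\{|\mathrm{MAC}^{(k)}|^{1/2},|\mathrm{MAR}^{(k)}|^{1/2}\}}.$$ Here $X_n=O_p(b_n)$ means: for every $\delta>0$ there is $B>0$ with $\mathbb P(|X_n|>B\,b_n)\le\delta$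 for all large $n$. -/

import Mathlib

open MeasureTheory ProbabilityTheory Filter Topology Asymptotics
open scoped ENNReal NNReal

namespace MSNN

universe u

/-- A multi-treatment causal matrix completion problem, with the latent factors `U`, `V` and the
treatment assignment `D` held fixed: all statements are conditional on `(U, V, D)`, so `P` is the
conditional law, the only randomness left is the noise, and `∫ ω, X ω ∂P` is `E[X | U, V, D]`.
Nothing is assumed here about how these data are related; the assumptions are stated below. -/
structure Model where
  /-- number of rows -/
  m : ℕ
  /-- number of columns -/
  n : ℕ
  /-- number of treatment levels -/
  L : ℕ
  /-- dimension of the latent factors -/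
  r : ℕ
  /-- sample space -/
  Ω : Type u
  [mΩ : MeasurableSpace Ω]
  /-- law of the noise, given the latent factors and the assignment -/
  P : Measure Ω
  [hP : IsProbabilityMeasure P]
  /-- potential outcomes, `Y d i j` -/
  Y : Fin L → Fin m → Fin n → Ω → ℝ
  /-- latent row factors, level by level -/
  U : Fin L → Fin m → Fin r → ℝ
  /-- latent column factors, level by level -/
  V : Fin L → Fin n → Fin r → ℝ
  /-- noise, `noise d i j` -/
  noise : Fin L → Fin m → Fin n → Ω → ℝ
  /-- treatment assignment; `none` is the absence of treatment (level `0`) -/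
  D : Fin m → Fin n → Option (Fin L)
  /-- range of the expected potential outcomes at each treatment level -/
  f : Fin L → ℝ

attribute [instance] Model.mΩ Model.hP

/-- The sub-gaussian norm `‖X‖_ψ₂ = inf {t > 0 | E exp (X² / t²) ≤ 2}`, with value `∞` if there is
no such `t`. -/
noncomputable def psi2Norm {Ω : Type*} [MeasurableSpace Ω] (P : Measure Ω) (X : Ω → ℝ) : ℝ≥0∞ :=
  ⨅ (t : ℝ≥0) (_ : 0 < t) (_ : ∫⁻ ω, ENNReal.ofReal (Real.exp ((X ω / (t : ℝ)) ^ 2)) ∂P ≤ 2),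
    (t : ℝ≥0∞)

/-- `X n = O_p (b n)`, each `X n` being defined on its own probability space. -/
def IsBigOInProbability {Ω : ℕ → Type*} [∀ n, MeasurableSpace (Ω n)] (P : ∀ n, Measure (Ω n))
    (X : ∀ n, Ω n → ℝ) (b : ℕ → ℝ) : Prop :=
  ∀ δ : ℝ≥0∞, 0 < δ → ∃ B : ℝ, 0 < B ∧ ∀ᶠ n in atTop, P n {ω | B * b n < |X n ω|} ≤ δ

namespace Model

variable (M : Model.{u})

/-- Expected potential outcome `A^(d)_ij`. -/
noncomputable def A (d : Fin M.L) (i : Fin M.m) (j : Fin M.n) : ℝ := ∫ ω, M.Y d i j ω ∂M.P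

/-- Observed outcome: the potential outcome at the assigned level (`0` if there is none). -/
def obs (a : Fin M.m) (b : Fin M.n) (ω : M.Ω) : ℝ :=
  match M.D a b with
  | some e => M.Y e a b ω
  | none => 0

/-! ### Assumptions on the model -/

/-- Low-rank factorization per treatment level. -/
def LowRank : Prop :=
  ∀ d i j ω, M.Y d i j ω = M.U d i ⬝ᵥ M.V d j + M.noise d i j ω

/-- Selection on latent factors: the noise has mean zero given `(U, V, D)`. -/
def Selection : Prop :=
  ∀ d i j, Integrable (M.noise d i j) M.P ∧ ∫ ω, M.noise d i j ω ∂M.P = 0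

/-- `β` is a coefficient vector for row `i` and the row set `I` at level `d`:
`u_i = ∑_{a ∈ I} β_a u_a`. -/
def IsCoeff (d : Fin M.L) (i : Fin M.m) (I : Finset (Fin M.m)) (β : EuclideanSpace ℝ I) : Prop :=
  M.U d i = ∑ a : I, β a • M.U d a

/-- Linear span inclusion on latent row factors, with constant `μ`. -/
def SpanInclusion (μ : ℕ) : Prop :=
  ∀ (d : Fin M.L) (i : Fin M.m) (I : Finset (Fin M.m)), i ∉ I → μ ≤ I.card →
    ∃ β : EuclideanSpace ℝ I, M.IsCoeff d i I β

/-- Shared latent row factors. -/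
def SharedRows : Prop := ∀ d d' i, M.U d i = M.U d' i

/-- Bounded expected potential outcomes, with positive level-dependent range `f`. -/
def BoundedOutcomes : Prop := (∀ d, 0 < M.f d) ∧ ∀ d i j, |M.A d i j| ≤ M.f d

/-- Independent mean-zero sub-gaussian noise with standard deviations `s d i j ≤ f d * σ` and
sub-gaussian norms at most `C * s d i j`. -/
def SubgaussianNoise (σ C : ℝ) : Prop :=
  (∀ d i j, AEMeasurable (M.noise d i j) M.P) ∧
  iIndepFun (fun t : Fin M.L × Fin M.m × Fin M.n => M.noise t.1 t.2.1 t.2.2) M.P ∧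
  (∀ d i j, ∫ ω, M.noise d i j ω ∂M.P = 0) ∧
  ∃ s : Fin M.L → Fin M.m → Fin M.n → ℝ, ∀ d i j,
    0 ≤ s d i j ∧ s d i j ≤ M.f d * σ ∧
    ∫ ω, M.noise d i j ω ^ 2 ∂M.P = s d i j ^ 2 ∧
    psi2Norm M.P (M.noise d i j) ≤ ENNReal.ofReal (C * s d i j)

end Model

/-- `K ≥ 1` subgroups of mixed anchor rows and columns for the entry `(i, j)` at level `d`, with
mutually disjoint row sets. -/
structure Subgroups (M : Model.{u}) (i : Fin M.m) (j : Fin M.n) (d : Fin M.L) where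
  /-- number of subgroups -/
  K : ℕ
  K_pos : 0 < K
  /-- mixed anchor rows -/
  MAR : Fin K → Finset (Fin M.m)
  /-- mixed anchor columns -/
  MAC : Fin K → Finset (Fin M.n)
  row_notMem : ∀ k, i ∉ MAR k
  col_notMem : ∀ k, j ∉ MAC k
  treated : ∀ k, ∀ b ∈ MAC k, M.D i b ≠ none
  same_treatment : ∀ k, ∀ a ∈ MAR k, ∀ b ∈ MAC k, M.D a b = M.D i b
  target_treatment : ∀ k, ∀ a ∈ MAR k, M.D a j = some d
  disjoint_rows : ∀ k k', k ≠ k' → Disjoint (MAR k) (MAR k')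

/-- `S = ∑_l τ_l u_l ⊗ v_l` is a singular value decomposition, with the singular values in
decreasing order (indices start at `0`). -/
structure IsSVD {ι κ : Type*} [Fintype ι] [Fintype κ] (S : Matrix ι κ ℝ)
    (τ : Fin (min (Fintype.card ι) (Fintype.card κ)) → ℝ)
    (u : Fin (min (Fintype.card ι) (Fintype.card κ)) → EuclideanSpace ℝ ι)
    (v : Fin (min (Fintype.card ι) (Fintype.card κ)) → EuclideanSpace ℝ κ) : Prop where
  nonneg : ∀ l, 0 ≤ τ l
  antitone : Antitone τ
  left_orthonormal : Orthonormal ℝ u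
  right_orthonormal : Orthonormal ℝ v
  decomp : ∀ a b, S a b = ∑ l, τ l * u l a * v l b

/-- Steps 2 to 4 of the algorithm, for one subgroup: `est = ⟨x, β̂⟩`, where
`β̂ = (∑_{l ≤ lam} τ_l⁻¹ u_l ⊗ v_l) q` for some singular value decomposition of `S`. -/
def IsTruncatedSVDEstimate {ι κ : Type*} [Fintype ι] [Fintype κ] (S : Matrix ι κ ℝ)
    (q : κ → ℝ) (x : ι → ℝ) (lam : ℕ) (est : ℝ) : Prop :=
  ∃ τ u v, IsSVD S τ u v ∧
    est = x ⬝ᵥ fun a => ∑ l with l.val < lam, 1 / τ l * u l a * ∑ b, v l b * q b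

namespace Subgroups

variable {M : Model.{u}} {i : Fin M.m} {j : Fin M.n} {d : Fin M.L} (G : Subgroups M i j d)

/-- The weight `w(b, d(b))` of column `b`, where `d(b)` is the treatment level of `(i, b)`; the
value at untreated `(i, b)` plays no role. -/
def colWeight (_ : Subgroups M i j d) (w : Fin M.n → Fin M.L → ℝ) (b : Fin M.n) : ℝ :=
  match M.D i b with
  | some e => w b e
  | none => 0

/-- The weighted mixed anchor matrix `S_w^(k)(d)`. -/
def S (w : Fin M.n → Fin M.L → ℝ) (k : Fin G.K) (ω : M.Ω) : Matrix (G.MAR k) (G.MAC k) ℝ :=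
  fun a b => G.colWeight w b * M.obs a b ω

/-- The weighted vector `q_w^(k)(d)`. -/
def q (w : Fin M.n → Fin M.L → ℝ) (k : Fin G.K) (ω : M.Ω) : G.MAC k → ℝ :=
  fun b => G.colWeight w b * M.obs i b ω

/-- The vector `x^(k)(d)`. -/
def x (k : Fin G.K) (ω : M.Ω) : G.MAR k → ℝ := fun a => M.obs a j ω

/-- `E[S_w^(k)(d)]`, given `(U, V, D)`. -/
noncomputable def ES (w : Fin M.n → Fin M.L → ℝ) (k : Fin G.K) : Matrix (G.MAR k) (G.MAC k) ℝ :=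
  fun a b => ∫ ω, G.S w k ω a b ∂M.P

/-- `E[x^(k)(d)]`, given `(U, V, D)`. -/
noncomputable def Ex (k : Fin G.K) : EuclideanSpace ℝ (G.MAR k) :=
  WithLp.toLp 2 fun a => ∫ ω, G.x k ω a ∂M.P

/-- `est` is an output of the algorithm on the sample `ω`, with weights `w` and truncation levels
`lam`. -/
def IsMSNNEstimate (w : Fin M.n → Fin M.L → ℝ) (lam : Fin G.K → ℕ) (ω : M.Ω) (est : ℝ) : Prop :=
  ∃ e : Fin G.K → ℝ,
    (∀ k, IsTruncatedSVDEstimate (G.S w k ω) (G.q w k ω) (G.x k ω) (lam k) (e k)) ∧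
    est = 1 / (G.K : ℝ) * ∑ k, e k

/-- `r^(k)`, the rank of `E[S_w^(k)(d)]`. -/
noncomputable def rk (w : Fin M.n → Fin M.L → ℝ) (k : Fin G.K) : ℕ := (G.ES w k).rank

/-- The column space of `E[S_w^(k)(d)]`. -/
noncomputable def colSpace (w : Fin M.n → Fin M.L → ℝ) (k : Fin G.K) :
    Submodule ℝ (EuclideanSpace ℝ (G.MAR k)) :=
  LinearMap.range (G.ES w k).toEuclideanLin

/-- Well balanced spectra: with `τ_1 ≥ ... ≥ τ_r` the non-zero singular values of `E[S_w^(k)(d)]`,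
one has `τ_r ≥ c τ_1` and `∑_l τ_l² = ‖E[S_w^(k)(d)]‖_F² ≥ c' |MAR| |MAC|`. -/
def WellBalanced (w : Fin M.n → Fin M.L → ℝ) (c c' : ℝ) : Prop :=
  ∀ k, c * (G.ES w k).toEuclideanLin.singularValues 0 ≤
      (G.ES w k).toEuclideanLin.singularValues (G.rk w k - 1) ∧
    c' * ((G.MAR k).card * (G.MAC k).card) ≤ ∑ a, ∑ b, G.ES w k a b ^ 2

/-- Subspace inclusion. -/
def SubspaceInclusion (w : Fin M.n → Fin M.L → ℝ) : Prop := ∀ k, G.Ex k ∈ G.colSpace w k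

/-- `β̃^(k)`, the orthogonal projection of `β^(k)` onto the column space of `E[S_w^(k)(d)]`. -/
noncomputable def projCoeff (w : Fin M.n → Fin M.L → ℝ) (k : Fin G.K)
    (β : EuclideanSpace ℝ (G.MAR k)) : EuclideanSpace ℝ (G.MAR k) :=
  (G.colSpace w k).starProjection β

/-- `error_{k,1}`. -/
noncomputable def error1 (w : Fin M.n → Fin M.L → ℝ) (k : Fin G.K) : ℝ :=
  √(G.rk w k : ℝ) / ((G.MAC k).card : ℝ) ^ (1 / 4 : ℝ)

/-- `error_{k,2}`. -/
noncomputable def error2 (w : Fin M.n → Fin M.L → ℝ) (k : Fin G.K)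
    (β : EuclideanSpace ℝ (G.MAR k)) : ℝ :=
  (G.rk w k : ℝ) ^ (3 / 2 : ℝ) * (∑ a, |G.projCoeff w k β a|) *
      √(Real.log (((G.MAC k).card : ℝ) * (G.MAR k).card)) /
    min √((G.MAC k).card : ℝ) √((G.MAR k).card : ℝ)

/-- `K⁻¹ {∑_k (error_{k,1} + error_{k,2}) + (∑_k ‖β̃^(k)‖₂²)^{1/2}}`. -/
noncomputable def bound (w : Fin M.n → Fin M.L → ℝ)
    (β : ∀ k : Fin G.K, EuclideanSpace ℝ (G.MAR k)) : ℝ :=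
  1 / (G.K : ℝ) *
    (∑ k, (G.error1 w k + G.error2 w k (β k)) + √(∑ k, ‖G.projCoeff w k (β k)‖ ^ 2))

end Subgroups

end MSNN

-- Fix a subgroup. Let T be `ES`, Δ the weighted noise matrix, Ŝ = T + Δ, b the projected
-- coefficient vector, η the noise of q, and x₀, ξ the mean and the noise of x divided by f(d).
-- After this normalisation the entries of T and x₀ are at most 1 and the noise is sub-gaussian with
-- a universal constant. Row factors do not depend on the level, so q has mean Tᵀb; subspace
-- inclusion gives A = f(d)⟨x₀, b⟩.
--
-- Let Π project onto the r leading left singular vectors of Ŝ, and let Q be the transposed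
-- pseudo-inverse of its truncation. From QŜᵀ = Π one gets β̂ = Πb + Qη − QΔᵀb, so the normalised
-- error is −⟨(1−Π)x₀, (1−Π)b⟩ + ⟨Πξ, b⟩ + ⟨x₀+ξ, Qη − QΔᵀb⟩ (`abs_truncInv_estimate_sub_le`). The
-- first term is quadratic in ‖Δ‖/θ, where θ is the least non-zero singular value of T, because x₀
-- and b both lie in the range of T. The other terms involve only Ŝᵀξ, Ŝη and Δᵀb, whose second
-- moments follow from independence; ‖Δ‖² is bounded by the Frobenius norm of ΔΔᵀ.
--
-- This needs the leading singular values of Ŝ to be at least θ/2. For that Δ has to be small only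
-- on the row space or on the column space of T, of dimension at most μ
-- (`HasSVD.half_le_singularValue`). Sub-gaussian tails on a basis make the failure probability
-- exponentially small in max(|MAR|, |MAC|), hence summable over K subgroups.
--
-- Balanced spectra give θ² ≳ |MAR||MAC|/r, and b = Ty with T bounded gives ‖b‖₂ ≲ √r ‖b‖₁/√|MAR|
-- (`sum_abs_lower_bound`). The expected error is then at most a constant times `error1 + error2`
-- (`add_le_mul_error_terms`), and Markov's inequality for the sum over subgroups concludes. The ℓ²
-- term of the bound is slack.

namespace MSNN

open scoped RealInnerProductSpace

universe u

-- Deterministic perturbation theory of truncated singular value decompositions.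

section SingularValueDecomposition

variable {E F : Type*} [NormedAddCommGroup E] [InnerProductSpace ℝ E]
  [NormedAddCommGroup F] [InnerProductSpace ℝ F]

theorem norm_sq_sum_smul_of_orthonormal {α : Type*} {u : α → E} (hu : Orthonormal ℝ u)
    (s : Finset α) (a : α → ℝ) : ‖∑ l ∈ s, a l • u l‖ ^ 2 = ∑ l ∈ s, a l ^ 2 := by
  rw [← real_inner_self_eq_norm_sq, hu.inner_sum]
  simp [sq]

theorem sum_inner_sq_le_norm_sq {α : Type*} {u : α → E} (hu : Orthonormal ℝ u)
    (s : Finset α) (x : E) : ∑ l ∈ s, ⟪u l, x⟫ ^ 2 ≤ ‖x‖ ^ 2 := by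
  simpa [sq_abs] using hu.sum_inner_products_le x (s := s)

/-- A singular value decomposition of a linear map between inner product spaces. -/
structure HasSVD (S : F →ₗ[ℝ] E) {N : ℕ} (τ : Fin N → ℝ) (u : Fin N → E) (v : Fin N → F) :
    Prop where
  nonneg : ∀ l, 0 ≤ τ l
  antitone : Antitone τ
  left_orthonormal : Orthonormal ℝ u
  right_orthonormal : Orthonormal ℝ v
  apply : ∀ y, S y = ∑ l, (τ l * ⟪v l, y⟫) • u l

/-- The orthogonal projection onto the span of the first `r` vectors of an orthonormal family. -/
noncomputable def leadingProj {N : ℕ} (u : Fin N → E) (r : ℕ) : E →ₗ[ℝ] E :=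
  ∑ l with l.val < r, (innerₛₗ ℝ (u l)).smulRight (u l)

/-- The transpose of the pseudo-inverse of the truncation at `r` of a singular value
decomposition. -/
noncomputable def truncInv {N : ℕ} (τ : Fin N → ℝ) (u : Fin N → E) (v : Fin N → F) (r : ℕ) :
    F →ₗ[ℝ] E :=
  ∑ l with l.val < r, (τ l)⁻¹ • (innerₛₗ ℝ (v l)).smulRight (u l)

variable {N : ℕ} {τ : Fin N → ℝ} {u : Fin N → E} {v : Fin N → F} {S : F →ₗ[ℝ] E}

theorem leadingProj_apply (u : Fin N → E) (r : ℕ) (x : E) :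
    leadingProj u r x = ∑ l with l.val < r, ⟪u l, x⟫ • u l := by
  simp [leadingProj]

theorem truncInv_apply (τ : Fin N → ℝ) (u : Fin N → E) (v : Fin N → F) (r : ℕ) (y : F) :
    truncInv τ u v r y = ∑ l with l.val < r, ((τ l)⁻¹ * ⟪v l, y⟫) • u l := by
  simp [truncInv, mul_smul]

theorem norm_sq_leadingProj (hu : Orthonormal ℝ u) (r : ℕ) (x : E) :
    ‖leadingProj u r x‖ ^ 2 = ∑ l with l.val < r, ⟪u l, x⟫ ^ 2 := by
  rw [leadingProj_apply, norm_sq_sum_smul_of_orthonormal hu]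

theorem inner_leadingProj_left (r : ℕ) (x y : E) :
    ⟪leadingProj u r x, y⟫ = ⟪x, leadingProj u r y⟫ := by
  simp only [leadingProj_apply, sum_inner, inner_sum, real_inner_smul_left, real_inner_smul_right]
  refine Finset.sum_congr rfl fun l _ => ?_
  rw [real_inner_comm x (u l)]
  ring

theorem leadingProj_leadingProj (hu : Orthonormal ℝ u) (r : ℕ) (x : E) :
    leadingProj u r (leadingProj u r x) = leadingProj u r x := by
  rw [leadingProj_apply, leadingProj_apply]
  refine Finset.sum_congr rfl fun l hl => ?_
  rw [hu.inner_right_sum _ hl]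

theorem norm_sub_leadingProj_le (hu : Orthonormal ℝ u) (r : ℕ) (x : E) :
    ‖x - leadingProj u r x‖ ≤ ‖x‖ := by
  refine le_of_sq_le_sq ?_ (norm_nonneg _)
  have h : ⟪x, leadingProj u r x⟫ = ‖leadingProj u r x‖ ^ 2 := by
    rw [← real_inner_self_eq_norm_sq, inner_leadingProj_left, leadingProj_leadingProj hu]
  rw [norm_sub_sq_real, h]
  nlinarith [sq_nonneg ‖leadingProj u r x‖]

/-- Self-adjointness and idempotence put 1 − Π on both arguments; this makes the error on the mean
part quadratic in the perturbation. -/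
theorem inner_sub_leadingProj (hu : Orthonormal ℝ u) (r : ℕ) (x y : E) :
    ⟪x, y - leadingProj u r y⟫ = ⟪x - leadingProj u r x, y - leadingProj u r y⟫ := by
  have h : ⟪leadingProj u r x, y - leadingProj u r y⟫ = 0 := by
    rw [inner_leadingProj_left, map_sub, leadingProj_leadingProj hu, sub_self, inner_zero_right]
  rw [inner_sub_left, h, sub_zero]

namespace HasSVD

theorem inner_left_apply (h : HasSVD S τ u v) (l : Fin N) (y : F) :
    ⟪u l, S y⟫ = τ l * ⟪v l, y⟫ := by
  rw [h.apply, h.left_orthonormal.inner_right_fintype]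

theorem norm_sq_apply (h : HasSVD S τ u v) (y : F) :
    ‖S y‖ ^ 2 = ∑ l, (τ l * ⟪v l, y⟫) ^ 2 := by
  rw [h.apply, norm_sq_sum_smul_of_orthonormal h.left_orthonormal]

theorem adjoint [FiniteDimensional ℝ E] [FiniteDimensional ℝ F] (h : HasSVD S τ u v) :
    HasSVD (LinearMap.adjoint S) τ v u where
  nonneg := h.nonneg
  antitone := h.antitone
  left_orthonormal := h.right_orthonormal
  right_orthonormal := h.left_orthonormal
  apply x := by
    refine ext_inner_right ℝ fun y => ?_
    rw [LinearMap.adjoint_inner_left, h.apply, inner_sum, sum_inner]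
    refine Finset.sum_congr rfl fun l _ => ?_
    rw [real_inner_smul_left, real_inner_smul_right, real_inner_comm x (u l)]
    ring

/-- Lower bound of a singular value in terms of a subspace on which the map is bounded below. -/
theorem le_singularValue [FiniteDimensional ℝ F] (h : HasSVD S τ u v) (W : Submodule ℝ F)
    {δ : ℝ} (hW : ∀ y ∈ W, δ * ‖y‖ ≤ ‖S y‖) (l : Fin N)
    (hl : l.val < Module.finrank ℝ W) : δ ≤ τ l := by
  let Φ : W →ₗ[ℝ] (Fin l.val → ℝ) :=
    LinearMap.pi fun k => (innerₛₗ ℝ (v ⟨k.val, k.isLt.trans l.isLt⟩)).comp W.subtype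
  -- Since `W` has dimension above `l`, it contains a non-zero vector orthogonal to the right
  -- singular vectors of index below `l`; on it `S` expands by at most `τ l`.
  have hker : LinearMap.ker Φ ≠ ⊥ := LinearMap.ker_ne_bot_of_finrank_lt (by simpa using hl)
  obtain ⟨y, hy, hy0⟩ := (Submodule.ne_bot_iff _).1 hker
  have hpos : 0 < ‖(y : F)‖ := norm_pos_iff.2 (by simpa using hy0)
  have hinner : ∀ k : Fin N, k < l → ⟪v k, (y : F)⟫ = 0 := fun k hk => by
    have := congrFun (LinearMap.mem_ker.1 hy) ⟨k.val, hk⟩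
    simpa [Φ] using this
  have h1 : ‖S y‖ ^ 2 ≤ (τ l * ‖(y : F)‖) ^ 2 := by
    rw [h.norm_sq_apply, mul_pow]
    refine le_trans ?_ (mul_le_mul_of_nonneg_left
      (sum_inner_sq_le_norm_sq h.right_orthonormal Finset.univ (y : F)) (sq_nonneg _))
    rw [Finset.mul_sum]
    refine Finset.sum_le_sum fun k _ => ?_
    rcases lt_or_ge k l with hk | hk
    · simp [hinner k hk]
    · rw [mul_pow]
      exact mul_le_mul_of_nonneg_right (pow_le_pow_left₀ (h.nonneg k) (h.antitone hk) 2)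
        (sq_nonneg _)
  have h2 := le_of_sq_le_sq h1 (mul_nonneg (h.nonneg l) hpos.le)
  exact le_of_mul_le_mul_right ((hW y y.2).trans h2) hpos

/-- Weyl's inequality for the perturbation of a map of low rank. -/
theorem singularValue_le [FiniteDimensional ℝ E] (h : HasSVD S τ u v)
    (T : F →ₗ[ℝ] E) {ν : ℝ} (hν : ∀ y, ‖S y - T y‖ ≤ ν * ‖y‖) (l : Fin N)
    (hl : Module.finrank ℝ (LinearMap.range T) ≤ l.val) : τ l ≤ ν := by
  let v' : Fin (l.val + 1) → F := fun k => v ⟨k.val, lt_of_lt_of_le k.isLt l.isLt⟩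
  have hv' : Orthonormal ℝ v' := h.right_orthonormal.comp _ fun a b hab => by
    simpa [Fin.ext_iff] using hab
  let Φ : (Fin (l.val + 1) → ℝ) →ₗ[ℝ] LinearMap.range T :=
    T.rangeRestrict.comp (Fintype.linearCombination ℝ v')
  -- The first `l + 1` right singular vectors span more dimensions than the rank of `T`, so some
  -- non-zero combination `y` is killed by `T`; there `S y = (S - T) y`, while `S` expands `y` by at
  -- least `τ l`.
  have hker : LinearMap.ker Φ ≠ ⊥ := LinearMap.ker_ne_bot_of_finrank_lt (by simp; omega)
  obtain ⟨a, ha, ha0⟩ := (Submodule.ne_bot_iff _).1 hker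
  set y : F := ∑ k, a k • v' k with hy
  have hT : T y = 0 := by
    have := congrArg Subtype.val (LinearMap.mem_ker.1 ha)
    simpa [Φ, Fintype.linearCombination_apply, hy] using this
  have hysq : ‖y‖ ^ 2 = ∑ k, a k ^ 2 := norm_sq_sum_smul_of_orthonormal hv' _ _
  have hpos : 0 < ‖y‖ := by
    obtain ⟨k, hk⟩ := Function.ne_iff.1 ha0
    have : 0 < ‖y‖ ^ 2 := by
      rw [hysq]
      exact Finset.sum_pos' (fun _ _ => sq_nonneg _) ⟨k, Finset.mem_univ _, by
        have : a k ≠ 0 := by simpa using hk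
        positivity⟩
    exact (norm_nonneg y).lt_of_ne' fun h0 => by simp [h0] at this
  have hinner : ∀ k, ⟪v' k, y⟫ = a k := fun k => by rw [hy, hv'.inner_right_fintype]
  have h1 : (τ l * ‖y‖) ^ 2 ≤ ‖S y‖ ^ 2 := by
    rw [h.norm_sq_apply, mul_pow, hysq, Finset.mul_sum]
    have hinj : Function.Injective
        fun k : Fin (l.val + 1) => (⟨k.val, lt_of_lt_of_le k.isLt l.isLt⟩ : Fin N) :=
      fun a b hab => by simpa [Fin.ext_iff] using hab
    calc ∑ k, τ l ^ 2 * a k ^ 2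
        ≤ ∑ k : Fin (l.val + 1), (τ ⟨k.val, lt_of_lt_of_le k.isLt l.isLt⟩ *
            ⟪v ⟨k.val, lt_of_lt_of_le k.isLt l.isLt⟩, y⟫) ^ 2 := by
          refine Finset.sum_le_sum fun k _ => ?_
          rw [mul_pow, show ⟪v ⟨k.val, lt_of_lt_of_le k.isLt l.isLt⟩, y⟫ = a k from hinner k]
          refine mul_le_mul_of_nonneg_right (pow_le_pow_left₀ (h.nonneg l) (h.antitone ?_) 2)
            (sq_nonneg _)
          exact Fin.le_def.2 (Nat.lt_succ_iff.1 k.isLt)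
      _ ≤ ∑ k, (τ k * ⟪v k, y⟫) ^ 2 := by
          rw [← Finset.sum_image (s := Finset.univ) (f := fun k => (τ k * ⟪v k, y⟫) ^ 2)
            (fun a _ b _ hab => hinj hab)]
          exact Finset.sum_le_sum_of_subset_of_nonneg (Finset.subset_univ _)
            fun _ _ _ => sq_nonneg _
  have h2 := le_of_sq_le_sq h1 (norm_nonneg _)
  have h3 := hν y
  rw [hT, sub_zero] at h3
  exact le_of_mul_le_mul_right (h2.trans h3) hpos

variable {r : ℕ} {t : ℝ}

theorem norm_truncInv_le (h : HasSVD S τ u v) (ht : 0 < t)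
    (hτ : ∀ l : Fin N, l.val < r → t ≤ τ l) (y : F) :
    ‖truncInv τ u v r y‖ ≤ ‖y‖ / t := by
  refine le_of_sq_le_sq ?_ (by positivity)
  rw [truncInv_apply, norm_sq_sum_smul_of_orthonormal h.left_orthonormal, div_pow,
    le_div_iff₀ (by positivity), Finset.sum_mul]
  refine le_trans (Finset.sum_le_sum fun l hl => ?_)
    (sum_inner_sq_le_norm_sq h.right_orthonormal (Finset.univ.filter fun l => l.val < r) y)
  have hl' := hτ l (Finset.mem_filter.1 hl).2
  have hτpos : 0 < τ l := ht.trans_le hl'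
  rw [mul_pow, inv_pow, mul_assoc, mul_comm, ← div_eq_mul_inv, div_le_iff₀ (by positivity)]
  exact mul_le_mul_of_nonneg_left (pow_le_pow_left₀ ht.le hl' 2) (sq_nonneg _)

/-- Uses ⟨u_l, x⟩ = τ_l⁻¹⟨v_l, S*x⟩. When x is noise independent of the noise in S, ‖S*x‖/t is of
smaller order than the trivial bound ‖x‖. -/
theorem norm_leadingProj_le_of_le [FiniteDimensional ℝ E] [FiniteDimensional ℝ F]
    (h : HasSVD S τ u v) (ht : 0 < t) (hτ : ∀ l : Fin N, l.val < r → t ≤ τ l) (x : E) :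
    ‖leadingProj u r x‖ ≤ ‖LinearMap.adjoint S x‖ / t := by
  refine le_of_sq_le_sq ?_ (by positivity)
  rw [norm_sq_leadingProj h.left_orthonormal, div_pow, le_div_iff₀ (by positivity),
    Finset.sum_mul]
  refine le_trans (Finset.sum_le_sum fun l hl => ?_)
    (sum_inner_sq_le_norm_sq h.right_orthonormal (Finset.univ.filter fun l => l.val < r) _)
  have hl' := hτ l (Finset.mem_filter.1 hl).2
  rw [h.adjoint.inner_left_apply, mul_pow, mul_comm]
  exact mul_le_mul_of_nonneg_right (pow_le_pow_left₀ ht.le hl' 2) (sq_nonneg _)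

/-- Here ⟨v_l, y⟩ = τ_l⁻¹⟨u_l, Sy⟩ costs a second factor 1/t, but for independent noise y the vector
Sy is small enough to improve on ‖y‖/t. -/
theorem norm_truncInv_le_apply (h : HasSVD S τ u v) (ht : 0 < t)
    (hτ : ∀ l : Fin N, l.val < r → t ≤ τ l) (y : F) :
    ‖truncInv τ u v r y‖ ≤ ‖S y‖ / t ^ 2 := by
  refine le_of_sq_le_sq ?_ (by positivity)
  rw [truncInv_apply, norm_sq_sum_smul_of_orthonormal h.left_orthonormal, div_pow,
    le_div_iff₀ (by positivity), Finset.sum_mul]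
  refine le_trans (Finset.sum_le_sum fun l hl => ?_)
    (sum_inner_sq_le_norm_sq h.left_orthonormal (Finset.univ.filter fun l => l.val < r) _)
  have hl' := hτ l (Finset.mem_filter.1 hl).2
  have hτpos : 0 < τ l := ht.trans_le hl'
  have h4 : (t ^ 2) ^ 2 ≤ (τ l ^ 2) ^ 2 :=
    pow_le_pow_left₀ (by positivity) (pow_le_pow_left₀ ht.le hl' 2) 2
  rw [h.inner_left_apply]
  calc ((τ l)⁻¹ * ⟪v l, y⟫) ^ 2 * (t ^ 2) ^ 2
      ≤ ((τ l)⁻¹ * ⟪v l, y⟫) ^ 2 * (τ l ^ 2) ^ 2 := mul_le_mul_of_nonneg_left h4 (sq_nonneg _)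
    _ = (τ l * ⟪v l, y⟫) ^ 2 := by field_simp

theorem truncInv_adjoint [FiniteDimensional ℝ E] [FiniteDimensional ℝ F]
    (h : HasSVD S τ u v) (hτ : ∀ l : Fin N, l.val < r → 0 < τ l) (x : E) :
    truncInv τ u v r (LinearMap.adjoint S x) = leadingProj u r x := by
  rw [truncInv_apply, leadingProj_apply]
  refine Finset.sum_congr rfl fun l hl => ?_
  rw [h.adjoint.inner_left_apply, inv_mul_cancel_left₀ (hτ l (Finset.mem_filter.1 hl).2).ne']

theorem norm_apply_sub_leadingProj_le (h : HasSVD S τ u v) {ν : ℝ} (hν : 0 ≤ ν)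
    (hτ : ∀ l : Fin N, r ≤ l.val → τ l ≤ ν) (y : F) :
    ‖S y - leadingProj u r (S y)‖ ≤ ν * ‖y‖ := by
  have h1 : S y - leadingProj u r (S y) =
      ∑ l with ¬ l.val < r, (τ l * ⟪v l, y⟫) • u l := by
    rw [leadingProj_apply, sub_eq_iff_eq_add']
    simp_rw [h.inner_left_apply]
    rw [Finset.sum_filter_add_sum_filter_not, h.apply]
  refine le_of_sq_le_sq ?_ (by positivity)
  rw [h1, norm_sq_sum_smul_of_orthonormal h.left_orthonormal, mul_pow]
  refine le_trans ?_ (mul_le_mul_of_nonneg_left (sum_inner_sq_le_norm_sq h.right_orthonormal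
    (Finset.univ.filter fun l => ¬ l.val < r) y) (sq_nonneg ν))
  rw [Finset.mul_sum]
  refine Finset.sum_le_sum fun l hl => ?_
  rw [mul_pow]
  exact mul_le_mul_of_nonneg_right (pow_le_pow_left₀ (h.nonneg l)
    (hτ l (not_lt.1 (Finset.mem_filter.1 hl).2)) 2) (sq_nonneg _)

end HasSVD

/-- Deterministic error bound for regression on a truncated singular value decomposition of
`T + Δ`, where `T` has rank `r` and smallest non-zero singular value at least `θ`. -/
theorem abs_truncInv_estimate_sub_le [FiniteDimensional ℝ E] [FiniteDimensional ℝ F]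
    {T Δ : F →ₗ[ℝ] E} (h : HasSVD (T + Δ) τ u v) {θ t ν : ℝ} (hθ : 0 < θ)
    (ht : 0 < t) (hν : 0 ≤ ν)
    (hpre : ∀ x ∈ LinearMap.range T, ∃ y, T y = x ∧ θ * ‖y‖ ≤ ‖x‖)
    (hτ : ∀ l : Fin N, l.val < Module.finrank ℝ (LinearMap.range T) → t ≤ τ l)
    (hΔ : ∀ y, ‖Δ y‖ ≤ ν * ‖y‖) {x₀ b : E} (hx₀ : x₀ ∈ LinearMap.range T)
    (hb : b ∈ LinearMap.range T) (ξ : E) (η : F) :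
    |⟪x₀ + ξ, truncInv τ u v (Module.finrank ℝ (LinearMap.range T))
        (LinearMap.adjoint T b + η)⟫ - ⟪x₀, b⟫| ≤
      4 * ν ^ 2 / θ ^ 2 * ‖x₀‖ * ‖b‖ + ‖LinearMap.adjoint (T + Δ) ξ‖ * ‖b‖ / t +
        (‖x₀‖ + ‖ξ‖) * (‖(T + Δ) η‖ / t ^ 2 + ‖LinearMap.adjoint Δ b‖ / t) := by
  set r := Module.finrank ℝ (LinearMap.range T)
  have hu := h.left_orthonormal
  -- Write x = Ty. One ν comes from the tail singular values of T + Δ, at most ν by Weyl since T has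
  -- rank r; the other comes from Δy.
  have hres : ∀ x ∈ LinearMap.range T, ‖x - leadingProj u r x‖ ≤ 2 * ν / θ * ‖x‖ := by
    intro x hx
    obtain ⟨y, rfl, hy⟩ := hpre x hx
    have h1 : T y - leadingProj u r (T y) =
        ((T + Δ) y - leadingProj u r ((T + Δ) y)) - (Δ y - leadingProj u r (Δ y)) := by
      simp only [LinearMap.add_apply, map_add]
      abel
    have h2 : ‖(T + Δ) y - leadingProj u r ((T + Δ) y)‖ ≤ ν * ‖y‖ :=
      h.norm_apply_sub_leadingProj_le hν
        (fun l hl => h.singularValue_le T (by simpa using hΔ) l hl) y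
    have h3 := (norm_sub_leadingProj_le hu r (Δ y)).trans (hΔ y)
    have h4 : ‖y‖ ≤ ‖T y‖ / θ := by rwa [le_div_iff₀ hθ, mul_comm]
    calc ‖T y - leadingProj u r (T y)‖ ≤ ν * ‖y‖ + ν * ‖y‖ := by
          rw [h1]; exact (norm_sub_le _ _).trans (add_le_add h2 h3)
      _ = 2 * ν * ‖y‖ := by ring
      _ ≤ 2 * ν * (‖T y‖ / θ) := by gcongr
      _ = 2 * ν / θ * ‖T y‖ := by ring
  -- T*b = (T+Δ)*b − Δ*b, and the truncated pseudo-inverse sends (T+Δ)*b to the leading projection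
  -- of b.
  have hdecomp : truncInv τ u v r (LinearMap.adjoint T b + η) =
      leadingProj u r b + truncInv τ u v r η - truncInv τ u v r (LinearMap.adjoint Δ b) := by
    rw [← h.truncInv_adjoint (fun l hl => ht.trans_le (hτ l hl)) b, map_add LinearMap.adjoint,
      LinearMap.add_apply, map_add, map_add]
    abel
  have hsplit : ⟪x₀ + ξ, truncInv τ u v r (LinearMap.adjoint T b + η)⟫ - ⟪x₀, b⟫ =
      -⟪x₀ - leadingProj u r x₀, b - leadingProj u r b⟫ + ⟪leadingProj u r ξ, b⟫ +
        (⟪x₀ + ξ, truncInv τ u v r η⟫ - ⟪x₀ + ξ, truncInv τ u v r (LinearMap.adjoint Δ b)⟫) := by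
    rw [hdecomp, ← inner_sub_leadingProj hu, inner_leadingProj_left]
    simp only [inner_add_right, inner_sub_right, inner_add_left]
    ring
  have hxξ : ‖x₀ + ξ‖ ≤ ‖x₀‖ + ‖ξ‖ := norm_add_le _ _
  have e1 : |⟪x₀ - leadingProj u r x₀, b - leadingProj u r b⟫| ≤
      4 * ν ^ 2 / θ ^ 2 * ‖x₀‖ * ‖b‖ := by
    refine (abs_real_inner_le_norm _ _).trans ?_
    refine (mul_le_mul (hres x₀ hx₀) (hres b hb) (norm_nonneg _) (by positivity)).trans_eq ?_
    ring
  have e2 : |⟪leadingProj u r ξ, b⟫| ≤ ‖LinearMap.adjoint (T + Δ) ξ‖ * ‖b‖ / t := by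
    refine (abs_real_inner_le_norm _ _).trans ?_
    rw [mul_div_right_comm]
    exact mul_le_mul_of_nonneg_right (h.norm_leadingProj_le_of_le ht hτ ξ) (norm_nonneg _)
  have e3 : |⟪x₀ + ξ, truncInv τ u v r η⟫| ≤ (‖x₀‖ + ‖ξ‖) * (‖(T + Δ) η‖ / t ^ 2) :=
    (abs_real_inner_le_norm _ _).trans
      (mul_le_mul hxξ (h.norm_truncInv_le_apply ht hτ η) (norm_nonneg _) (by positivity))
  have e4 : |⟪x₀ + ξ, truncInv τ u v r (LinearMap.adjoint Δ b)⟫| ≤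
      (‖x₀‖ + ‖ξ‖) * (‖LinearMap.adjoint Δ b‖ / t) :=
    (abs_real_inner_le_norm _ _).trans
      (mul_le_mul hxξ (h.norm_truncInv_le ht hτ _) (norm_nonneg _) (by positivity))
  rw [hsplit, mul_add]
  rw [abs_le] at *
  constructor <;> linarith [e1.1, e1.2, e2.1, e2.2, e3.1, e3.2, e4.1, e4.2]

end SingularValueDecomposition

-- Singular values of the mean matrix and their stability.

section SingularValues

variable {E F : Type*} [NormedAddCommGroup E] [InnerProductSpace ℝ E] [FiniteDimensional ℝ E]
  [NormedAddCommGroup F] [InnerProductSpace ℝ F] [FiniteDimensional ℝ F] (T : F →ₗ[ℝ] E)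

theorem exists_orthonormalBasis_norm_sq_apply :
    ∃ b : OrthonormalBasis (Fin (Module.finrank ℝ F)) ℝ F,
      ∀ y, ‖T y‖ ^ 2 = ∑ l : Fin _, (T.singularValues l * ⟪b l, y⟫) ^ 2 := by
  have hsym := T.isSymmetric_adjoint_comp_self
  refine ⟨hsym.eigenvectorBasis rfl, fun y => ?_⟩
  have h1 : ‖T y‖ ^ 2 = ⟪y, (LinearMap.adjoint T ∘ₗ T) y⟫ := by
    rw [LinearMap.comp_apply, LinearMap.adjoint_inner_right, real_inner_self_eq_norm_sq]
  rw [h1, ← (hsym.eigenvectorBasis rfl).sum_inner_mul_inner]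
  refine Finset.sum_congr rfl fun l _ => ?_
  rw [← hsym, hsym.apply_eigenvectorBasis, ← T.sq_singularValues_fin rfl l]
  simp only [RCLike.ofReal_real_eq_id, id, real_inner_smul_left]
  rw [real_inner_comm (hsym.eigenvectorBasis rfl l) y]
  ring

theorem norm_apply_le_singularValues_zero (y : F) : ‖T y‖ ≤ T.singularValues 0 * ‖y‖ := by
  obtain ⟨b, hb⟩ := exists_orthonormalBasis_norm_sq_apply T
  refine le_of_sq_le_sq ?_ (mul_nonneg (T.singularValues_nonneg 0) (norm_nonneg _))
  rw [hb, mul_pow, ← b.sum_sq_norm_inner_right y, Finset.mul_sum]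
  refine Finset.sum_le_sum fun l _ => ?_
  rw [mul_pow, Real.norm_eq_abs, sq_abs]
  exact mul_le_mul_of_nonneg_right (pow_le_pow_left₀ (T.singularValues_nonneg l)
    (T.singularValues_antitone (Nat.zero_le _)) 2) (sq_nonneg _)

theorem singularValues_mul_norm_le_of_mem_ker_orthogonal {y : F}
    (hy : y ∈ (LinearMap.ker T)ᗮ) :
    T.singularValues (Module.finrank ℝ (LinearMap.range T) - 1) * ‖y‖ ≤ ‖T y‖ := by
  obtain ⟨b, hb⟩ := exists_orthonormalBasis_norm_sq_apply T
  refine le_of_sq_le_sq ?_ (norm_nonneg _)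
  rw [hb, mul_pow, ← b.sum_sq_norm_inner_right y, Finset.mul_sum]
  refine Finset.sum_le_sum fun l _ => ?_
  rw [mul_pow, Real.norm_eq_abs, sq_abs]
  by_cases hl : l.val < Module.finrank ℝ (LinearMap.range T)
  · exact mul_le_mul_of_nonneg_right (pow_le_pow_left₀ (T.singularValues_nonneg _)
      (T.singularValues_antitone (Nat.le_sub_one_of_lt hl)) 2) (sq_nonneg _)
  -- Beyond the rank the basis vectors lie in the kernel, so `y` has no component along them.
  · have h0 : T.singularValues l = 0 :=
      T.singularValues_eq_zero_iff_le_finrank_range.2 (not_lt.1 hl)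
    have hker : b l ∈ LinearMap.ker T := by
      rw [LinearMap.mem_ker, ← norm_eq_zero, ← sq_eq_zero_iff, hb]
      refine Finset.sum_eq_zero fun k _ => ?_
      rw [b.inner_eq_ite]
      split_ifs with hkl
      · simp [hkl, h0]
      · simp
    simp [(Submodule.mem_orthogonal _ _).1 hy _ hker]

/-- The preimage orthogonal to the kernel is the pseudo-inverse image, of norm at most ‖x‖ over the
least non-zero singular value. -/
theorem exists_preimage_singularValues_mul_norm_le {x : E} (hx : x ∈ LinearMap.range T) :
    ∃ y, T y = x ∧
      T.singularValues (Module.finrank ℝ (LinearMap.range T) - 1) * ‖y‖ ≤ ‖x‖ := by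
  obtain ⟨z, rfl⟩ := hx
  refine ⟨(LinearMap.ker T)ᗮ.starProjection z, ?_, ?_⟩
  · rw [Submodule.starProjection_orthogonal']
    have : T ((LinearMap.ker T).starProjection z) = 0 :=
      LinearMap.mem_ker.1 (Submodule.starProjection_apply_mem _ _)
    simp [this]
  · have hT : T ((LinearMap.ker T)ᗮ.starProjection z) = T z := by
      rw [Submodule.starProjection_orthogonal']
      have : T ((LinearMap.ker T).starProjection z) = 0 :=
        LinearMap.mem_ker.1 (Submodule.starProjection_apply_mem _ _)
      simp [this]
    rw [← hT]
    exact singularValues_mul_norm_le_of_mem_ker_orthogonal T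
      (Submodule.starProjection_apply_mem _ _)

theorem singularValues_mul_norm_le_adjoint {x : E} (hx : x ∈ LinearMap.range T) :
    T.singularValues (Module.finrank ℝ (LinearMap.range T) - 1) * ‖x‖ ≤
      ‖LinearMap.adjoint T x‖ := by
  obtain ⟨y, rfl, hy⟩ := exists_preimage_singularValues_mul_norm_le T hx
  rcases (norm_nonneg (T y)).eq_or_lt with h0 | hpos
  · rw [← h0, mul_zero]
    exact norm_nonneg _
  have h1 : ‖T y‖ ^ 2 ≤ ‖y‖ * ‖LinearMap.adjoint T (T y)‖ := by
    rw [← real_inner_self_eq_norm_sq, ← LinearMap.adjoint_inner_right]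
    exact real_inner_le_norm _ _
  have hσ := T.singularValues_nonneg (Module.finrank ℝ (LinearMap.range T) - 1)
  refine le_of_mul_le_mul_right ?_ hpos
  nlinarith [mul_le_mul_of_nonneg_left h1 hσ,
    mul_le_mul_of_nonneg_right hy (norm_nonneg (LinearMap.adjoint T (T y)))]

theorem norm_adjoint_apply_le_singularValues_zero (x : E) :
    ‖LinearMap.adjoint T x‖ ≤ T.singularValues 0 * ‖x‖ := by
  rcases (norm_nonneg (LinearMap.adjoint T x)).eq_or_lt with h0 | hpos
  · rw [← h0]
    exact mul_nonneg (T.singularValues_nonneg 0) (norm_nonneg _)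
  have h1 : ‖LinearMap.adjoint T x‖ ^ 2 ≤ ‖T (LinearMap.adjoint T x)‖ * ‖x‖ := by
    rw [← real_inner_self_eq_norm_sq, LinearMap.adjoint_inner_right]
    exact real_inner_le_norm _ _
  have h2 := norm_apply_le_singularValues_zero T (LinearMap.adjoint T x)
  refine le_of_mul_le_mul_right ?_ hpos
  nlinarith [mul_le_mul_of_nonneg_right h2 (norm_nonneg x)]

/-- The left side is the squared Hilbert–Schmidt norm. Expanding T e_b in an orthonormal basis w of
the range and exchanging sums leaves one term ‖T*w_l‖² per dimension of the range. -/
theorem sum_norm_sq_apply_le {κ : Type*} [Fintype κ] (e : OrthonormalBasis κ ℝ F) :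
    ∑ b, ‖T (e b)‖ ^ 2 ≤
      Module.finrank ℝ (LinearMap.range T) * T.singularValues 0 ^ 2 := by
  set w := stdOrthonormalBasis ℝ (LinearMap.range T)
  have h1 : ∀ b, ‖T (e b)‖ ^ 2 = ∑ l, ⟪e b, LinearMap.adjoint T (w l : E)⟫ ^ 2 := fun b => by
    have := w.sum_sq_norm_inner_right ⟨T (e b), LinearMap.mem_range_self _ _⟩
    rw [Submodule.coe_norm] at this
    rw [← this]
    refine Finset.sum_congr rfl fun l _ => ?_
    rw [Real.norm_eq_abs, sq_abs, Submodule.coe_inner, LinearMap.adjoint_inner_right,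
      real_inner_comm]
  have h2 : ∀ l, ∑ b, ⟪e b, LinearMap.adjoint T (w l : E)⟫ ^ 2 ≤ T.singularValues 0 ^ 2 :=
    fun l => by
    have h3 := e.sum_sq_norm_inner_right (LinearMap.adjoint T (w l : E))
    simp only [Real.norm_eq_abs, sq_abs] at h3
    rw [h3]
    have h4 := norm_adjoint_apply_le_singularValues_zero T (w l : E)
    have h5 : ‖(w l : E)‖ = 1 := by rw [← Submodule.coe_norm]; exact w.norm_eq_one l
    rw [h5, mul_one] at h4
    exact pow_le_pow_left₀ (norm_nonneg _) h4 2
  calc ∑ b, ‖T (e b)‖ ^ 2 = ∑ l, ∑ b, ⟪e b, LinearMap.adjoint T (w l : E)⟫ ^ 2 := by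
        simp_rw [h1]; exact Finset.sum_comm
    _ ≤ ∑ _l : Fin (Module.finrank ℝ (LinearMap.range T)), T.singularValues 0 ^ 2 :=
        Finset.sum_le_sum fun l _ => h2 l
    _ = _ := by simp

theorem finrank_ker_orthogonal {E F : Type*} [AddCommGroup E] [Module ℝ E]
    [NormedAddCommGroup F] [InnerProductSpace ℝ F] [FiniteDimensional ℝ F] (T : F →ₗ[ℝ] E) :
    Module.finrank ℝ (LinearMap.ker T)ᗮ = Module.finrank ℝ (LinearMap.range T) := by
  have h1 := Submodule.finrank_add_finrank_orthogonal (LinearMap.ker T)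
  have h2 := T.finrank_range_add_finrank_ker
  omega

/-- Stability of the leading singular values under a perturbation that is small on the row space
or on the column space. -/
theorem HasSVD.half_le_singularValue {N : ℕ} {τ : Fin N → ℝ} {u : Fin N → E} {v : Fin N → F}
    {T Δ : F →ₗ[ℝ] E} (h : HasSVD (T + Δ) τ u v) {θ : ℝ}
    (hθ : θ = T.singularValues (Module.finrank ℝ (LinearMap.range T) - 1))
    (hsmall : (∀ y ∈ (LinearMap.ker T)ᗮ, ‖Δ y‖ ≤ θ / 2 * ‖y‖) ∨
      ∀ x ∈ LinearMap.range T, ‖LinearMap.adjoint Δ x‖ ≤ θ / 2 * ‖x‖)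
    (l : Fin N) (hl : l.val < Module.finrank ℝ (LinearMap.range T)) : θ / 2 ≤ τ l := by
  -- Both subspaces have the rank of `T` as dimension, so the min-max bound applies to the map or to
  -- its adjoint, which share the singular values `τ`.
  rcases hsmall with hs | hs
  · refine h.le_singularValue (LinearMap.ker T)ᗮ (fun y hy => ?_) l
      (by rwa [finrank_ker_orthogonal])
    have h1 := singularValues_mul_norm_le_of_mem_ker_orthogonal T hy
    rw [← hθ] at h1
    have h2 := norm_sub_norm_le (T y) (-(Δ y))
    rw [sub_neg_eq_add, norm_neg] at h2
    rw [LinearMap.add_apply]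
    linarith [hs y hy]
  · refine h.adjoint.le_singularValue (LinearMap.range T) (fun x hx => ?_) l hl
    have h1 := singularValues_mul_norm_le_adjoint T hx
    rw [← hθ] at h1
    have h2 := norm_sub_norm_le (LinearMap.adjoint T x) (-(LinearMap.adjoint Δ x))
    rw [sub_neg_eq_add, norm_neg] at h2
    rw [map_add, LinearMap.add_apply]
    linarith [hs x hx]

end SingularValues

-- Translation between matrices and linear maps of Euclidean spaces.

section Matrices

variable {ι κ : Type*} [Fintype κ]

theorem euclidean_norm_sq (x : EuclideanSpace ℝ κ) : ‖x‖ ^ 2 = ∑ a, x a ^ 2 := by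
  simp [EuclideanSpace.norm_sq_eq]

theorem euclidean_norm_eq (x : EuclideanSpace ℝ κ) : ‖x‖ = √(∑ a, x a ^ 2) := by
  rw [← euclidean_norm_sq, Real.sqrt_sq (norm_nonneg x)]

theorem toEuclideanLin_apply_apply [DecidableEq κ] (A : Matrix ι κ ℝ) (y : EuclideanSpace ℝ κ) (a : ι) :
    A.toEuclideanLin y a = ∑ b, A a b * y b := by
  simp [Matrix.toLpLin_apply, Matrix.mulVec, dotProduct]

variable [Fintype ι]

theorem dotProduct_truncInv {N : ℕ} (τ : Fin N → ℝ) (u : Fin N → EuclideanSpace ℝ ι)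
    (v : Fin N → EuclideanSpace ℝ κ) (r : ℕ) (x : ι → ℝ) (q : κ → ℝ) :
    (x ⬝ᵥ fun a => ∑ l with l.val < r, 1 / τ l * u l a * ∑ b, v l b * q b) =
      ⟪(WithLp.toLp 2 x : EuclideanSpace ℝ ι), truncInv τ u v r (WithLp.toLp 2 q)⟫ := by
  rw [truncInv_apply, EuclideanSpace.inner_eq_star_dotProduct, dotProduct_comm]
  simp only [star_trivial]
  congr 1
  ext a
  simp only [WithLp.ofLp_sum, WithLp.ofLp_smul, Finset.sum_apply, Pi.smul_apply, smul_eq_mul]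
  refine Finset.sum_congr rfl fun l _ => ?_
  rw [PiLp.inner_apply]
  simp only [RCLike.inner_apply, conj_trivial]
  rw [one_div, mul_right_comm]
  congr 2
  exact Finset.sum_congr rfl fun b _ => mul_comm _ _

theorem rank_eq_finrank_range_toEuclideanLin [DecidableEq κ] (A : Matrix ι κ ℝ) :
    A.rank = Module.finrank ℝ (LinearMap.range A.toEuclideanLin) := by
  rw [A.rank_eq_finrank_range_toLin (EuclideanSpace.basisFun ι ℝ).toBasis
    (EuclideanSpace.basisFun κ ℝ).toBasis, Matrix.toEuclideanLin_eq_toLin_orthonormal]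

variable [DecidableEq κ]

theorem sum_sq_le_rank_mul_singularValues_sq (A : Matrix ι κ ℝ) :
    ∑ a, ∑ b, A a b ^ 2 ≤ A.rank * A.toEuclideanLin.singularValues 0 ^ 2 := by
  rw [rank_eq_finrank_range_toEuclideanLin, Finset.sum_comm]
  refine le_trans (le_of_eq (Finset.sum_congr rfl fun b _ => ?_))
    (sum_norm_sq_apply_le A.toEuclideanLin (EuclideanSpace.basisFun κ ℝ))
  rw [euclidean_norm_sq]
  refine Finset.sum_congr rfl fun a _ => ?_
  rw [toEuclideanLin_apply_apply]
  simp

theorem IsSVD.hasSVD {A : Matrix ι κ ℝ}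
    {τ : Fin (min (Fintype.card ι) (Fintype.card κ)) → ℝ}
    {u : Fin (min (Fintype.card ι) (Fintype.card κ)) → EuclideanSpace ℝ ι}
    {v : Fin (min (Fintype.card ι) (Fintype.card κ)) → EuclideanSpace ℝ κ}
    (h : IsSVD A τ u v) : HasSVD A.toEuclideanLin τ u v where
  nonneg := h.nonneg
  antitone := h.antitone
  left_orthonormal := h.left_orthonormal
  right_orthonormal := h.right_orthonormal
  apply y := by
    ext a
    rw [toEuclideanLin_apply_apply]
    simp only [h.decomp, WithLp.ofLp_sum, WithLp.ofLp_smul, Finset.sum_apply, Pi.smul_apply,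
      smul_eq_mul, PiLp.inner_apply, Finset.sum_mul, Finset.mul_sum, RCLike.inner_apply,
      conj_trivial]
    rw [Finset.sum_comm]
    refine Finset.sum_congr rfl fun l _ => Finset.sum_congr rfl fun b _ => ?_
    ring

variable [DecidableEq ι]

theorem adjoint_toEuclideanLin_apply (A : Matrix ι κ ℝ) (x : EuclideanSpace ℝ ι) (b : κ) :
    LinearMap.adjoint A.toEuclideanLin x b = ∑ a, A a b * x a := by
  rw [← Matrix.toEuclideanLin_conjTranspose_eq_adjoint, toEuclideanLin_apply_apply]
  simp

/-- The operator norm of a matrix in terms of the Frobenius norm of its Gram matrix. -/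
theorem norm_sq_toEuclideanLin_le (A : Matrix ι κ ℝ) (y : EuclideanSpace ℝ κ) :
    ‖A.toEuclideanLin y‖ ^ 2 ≤ √(∑ a, ∑ a', (∑ b, A a b * A a' b) ^ 2) * ‖y‖ ^ 2 := by
  set Γ := ∑ a, ∑ a', (∑ b, A a b * A a' b) ^ 2 with hΓ
  set z := A.toEuclideanLin y with hz
  -- ‖Aᵀz‖² = ⟨z, AAᵀz⟩, and Cauchy–Schwarz over pairs of rows brings in the Frobenius norm of AAᵀ.
  have h1 : ‖LinearMap.adjoint A.toEuclideanLin z‖ ^ 2 ≤ √Γ * ‖z‖ ^ 2 := by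
    have h2 : ‖LinearMap.adjoint A.toEuclideanLin z‖ ^ 2 =
        ∑ p : ι × ι, (∑ b, A p.1 b * A p.2 b) * (z p.1 * z p.2) := by
      rw [euclidean_norm_sq, Fintype.sum_prod_type]
      simp_rw [adjoint_toEuclideanLin_apply, sq, Finset.sum_mul_sum, Finset.sum_mul]
      rw [Finset.sum_comm]
      refine Finset.sum_congr rfl fun a _ => ?_
      rw [Finset.sum_comm]
      refine Finset.sum_congr rfl fun a' _ => Finset.sum_congr rfl fun b _ => ?_
      ring
    have h3 : ∑ p : ι × ι, (z p.1 * z p.2) ^ 2 = (‖z‖ ^ 2) ^ 2 := by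
      rw [euclidean_norm_sq, Fintype.sum_prod_type, sq (∑ a, z a ^ 2), Finset.sum_mul_sum]
      simp_rw [mul_pow]
    rw [h2]
    refine (Real.sum_mul_le_sqrt_mul_sqrt _ _ _).trans_eq ?_
    rw [h3, Real.sqrt_sq (by positivity), Fintype.sum_prod_type]
  have h4 : ‖z‖ ^ 2 ≤ ‖y‖ * ‖LinearMap.adjoint A.toEuclideanLin z‖ := by
    rw [← real_inner_self_eq_norm_sq]
    conv_lhs => rw [hz, ← LinearMap.adjoint_inner_right]
    exact real_inner_le_norm _ _
  rcases (norm_nonneg z).eq_or_lt with h0 | hpos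
  · rw [← h0, zero_pow two_ne_zero]
    exact mul_nonneg (Real.sqrt_nonneg _) (sq_nonneg _)
  have h5 : (‖z‖ ^ 2) ^ 2 ≤ ‖y‖ ^ 2 * (√Γ * ‖z‖ ^ 2) := by
    refine (pow_le_pow_left₀ (by positivity) h4 2).trans ?_
    rw [mul_pow]
    gcongr
  have hpos2 : 0 < ‖z‖ ^ 2 := by positivity
  refine le_of_mul_le_mul_right ?_ hpos2
  linarith

end Matrices

theorem exp_le_add_exp_sq (x : ℝ) : Real.exp x ≤ x + Real.exp (x ^ 2) := by
  have hsq := Real.add_one_le_exp (x ^ 2)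
  rcases le_or_gt |x| 1 with h | h
  · have := (abs_le.1 (Real.abs_exp_sub_one_sub_id_le h)).2
    linarith
  · rcases lt_abs.1 h with h | h
    · have : Real.exp x ≤ Real.exp (x ^ 2) := Real.exp_le_exp.2 (by nlinarith)
      linarith
    · have : Real.exp x ≤ 1 := Real.exp_le_one_iff.2 (by linarith)
      nlinarith

theorem exp_mul_le_of_mem_Icc {s : ℝ} (hs : 0 ≤ s) (hs' : s ≤ 1) (y : ℝ) :
    Real.exp (s * y) ≤ 1 - s + s * Real.exp y := by
  have := convexOn_exp.2 (Set.mem_univ 0) (Set.mem_univ y) (sub_nonneg.2 hs') hs (by ring)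
  simpa using this

-- Calculus of second moments.

section SecondMoments

variable {Ω : Type*} [MeasurableSpace Ω] {P : Measure Ω}

/-- `Z` is square integrable, with second moment at most `K`. -/
def HasSecondMomentLE (P : Measure Ω) (Z : Ω → ℝ) (K : ℝ) : Prop :=
  MemLp Z 2 P ∧ ∫ ω, Z ω ^ 2 ∂P ≤ K

namespace HasSecondMomentLE

theorem mono {Z : Ω → ℝ} {K K' : ℝ} (h : HasSecondMomentLE P Z K) (hK : K ≤ K') :
    HasSecondMomentLE P Z K' :=
  ⟨h.1, h.2.trans hK⟩

theorem nonneg {Z : Ω → ℝ} {K : ℝ} (h : HasSecondMomentLE P Z K) : 0 ≤ K :=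
  (integral_nonneg fun _ => sq_nonneg _).trans h.2

theorem const [IsProbabilityMeasure P] (a : ℝ) : HasSecondMomentLE P (fun _ => a) (a ^ 2) :=
  ⟨memLp_const a, by simp⟩

theorem add {Z W : Ω → ℝ} {K K' : ℝ} (hZ : HasSecondMomentLE P Z K)
    (hW : HasSecondMomentLE P W K') :
    HasSecondMomentLE P (fun ω => Z ω + W ω) (2 * K + 2 * K') := by
  refine ⟨hZ.1.add hW.1, ?_⟩
  calc ∫ ω, (Z ω + W ω) ^ 2 ∂P ≤ ∫ ω, (2 * Z ω ^ 2 + 2 * W ω ^ 2) ∂P := by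
        refine integral_mono (hZ.1.add hW.1).integrable_sq
          ((hZ.1.integrable_sq.const_mul 2).add (hW.1.integrable_sq.const_mul 2)) fun ω => ?_
        show (Z ω + W ω) ^ 2 ≤ 2 * Z ω ^ 2 + 2 * W ω ^ 2
        nlinarith [sq_nonneg (Z ω - W ω)]
    _ = 2 * ∫ ω, Z ω ^ 2 ∂P + 2 * ∫ ω, W ω ^ 2 ∂P := by
        rw [integral_add (hZ.1.integrable_sq.const_mul 2) (hW.1.integrable_sq.const_mul 2),
          integral_const_mul, integral_const_mul]
    _ ≤ 2 * K + 2 * K' := by linarith [hZ.2, hW.2]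

theorem const_mul {Z : Ω → ℝ} {K : ℝ} (hZ : HasSecondMomentLE P Z K) (a : ℝ) :
    HasSecondMomentLE P (fun ω => a * Z ω) (a ^ 2 * K) := by
  refine ⟨hZ.1.const_mul a, ?_⟩
  simp_rw [mul_pow]
  rw [integral_const_mul]
  exact mul_le_mul_of_nonneg_left hZ.2 (sq_nonneg a)

theorem sqrt_sum {α : Type*} [Fintype α] {Z : α → Ω → ℝ} {K : α → ℝ}
    (h : ∀ a, HasSecondMomentLE P (Z a) (K a)) :
    HasSecondMomentLE P (fun ω => √(∑ a, Z a ω ^ 2)) (∑ a, K a) := by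
  have hsq : ∀ ω, √(∑ a, Z a ω ^ 2) ^ 2 = ∑ a, Z a ω ^ 2 := fun ω =>
    Real.sq_sqrt (Finset.sum_nonneg fun _ _ => sq_nonneg _)
  have hint : Integrable (fun ω => ∑ a, Z a ω ^ 2) P :=
    integrable_finsetSum _ fun a _ => (h a).1.integrable_sq
  constructor
  · rw [memLp_two_iff_integrable_sq
      (Real.continuous_sqrt.comp_aestronglyMeasurable hint.aestronglyMeasurable)]
    simpa only [hsq] using hint
  · simp_rw [hsq]
    rw [integral_finsetSum _ fun a _ => (h a).1.integrable_sq]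
    exact Finset.sum_le_sum fun a _ => (h a).2

theorem integrable_mul {Z W : Ω → ℝ} {K K' : ℝ} (hZ : HasSecondMomentLE P Z K)
    (hW : HasSecondMomentLE P W K') : Integrable (fun ω => Z ω * W ω) P :=
  hZ.1.integrable_mul hW.1

theorem integral_mul_le {Z W : Ω → ℝ} {K K' : ℝ} (hZ : HasSecondMomentLE P Z K)
    (hW : HasSecondMomentLE P W K') : ∫ ω, Z ω * W ω ∂P ≤ √(K * K') := by
  refine Real.le_sqrt_of_sq_le ?_
  have hint := hZ.integrable_mul hW
  -- Cauchy–Schwarz by the discriminant of the non-negative quadratic E(xZ + W)².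
  have hquad : ∀ x : ℝ, 0 ≤ (∫ ω, Z ω ^ 2 ∂P) * (x * x) + (2 * ∫ ω, Z ω * W ω ∂P) * x +
      ∫ ω, W ω ^ 2 ∂P := fun x => by
    have h1 : ∫ ω, (x * Z ω + W ω) ^ 2 ∂P = (∫ ω, Z ω ^ 2 ∂P) * (x * x) +
        (2 * ∫ ω, Z ω * W ω ∂P) * x + ∫ ω, W ω ^ 2 ∂P := by
      have h2 : Integrable (fun ω => Z ω ^ 2 * (x * x) + 2 * (Z ω * W ω) * x) P :=
        (hZ.1.integrable_sq.mul_const _).add ((hint.const_mul 2).mul_const x)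
      rw [← integral_const_mul, ← integral_mul_const, ← integral_mul_const,
        ← integral_add (hZ.1.integrable_sq.mul_const _) ((hint.const_mul 2).mul_const x),
        ← integral_add h2 hW.1.integrable_sq]
      refine integral_congr_ae (Eventually.of_forall fun ω => ?_)
      show (x * Z ω + W ω) ^ 2 = Z ω ^ 2 * (x * x) + 2 * (Z ω * W ω) * x + W ω ^ 2
      ring
    rw [← h1]
    exact integral_nonneg fun _ => sq_nonneg _
  have hd := discrim_le_zero hquad
  unfold discrim at hd
  have h2 : (∫ ω, Z ω ^ 2 ∂P) * ∫ ω, W ω ^ 2 ∂P ≤ K * K' :=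
    mul_le_mul hZ.2 hW.2 (integral_nonneg fun _ => sq_nonneg _) hZ.nonneg
  nlinarith

theorem integral_le [IsProbabilityMeasure P] {Z : Ω → ℝ} {K : ℝ}
    (hZ : HasSecondMomentLE P Z K) : Integrable Z P ∧ ∫ ω, Z ω ∂P ≤ √K := by
  have h1 := hZ.integral_mul_le (const (P := P) 1)
  have h2 := hZ.integrable_mul (const (P := P) 1)
  simp only [mul_one, one_pow] at h1 h2
  exact ⟨h2, h1⟩

theorem sum_of_pairwise_indepFun [IsProbabilityMeasure P] {α : Type*} [Fintype α]
    {Z : α → Ω → ℝ} {K : α → ℝ} (h : ∀ a, HasSecondMomentLE P (Z a) (K a))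
    (hmean : ∀ a, ∫ ω, Z a ω ∂P = 0)
    (hind : Pairwise fun a a' => IndepFun (Z a) (Z a') P) :
    HasSecondMomentLE P (fun ω => ∑ a, Z a ω) (∑ a, K a) := by
  have hmem : MemLp (∑ a, Z a) 2 P := memLp_finsetSum' _ fun a _ => (h a).1
  have hfun : (fun ω => ∑ a, Z a ω) = ∑ a, Z a := by ext; simp
  have hvar := IndepFun.variance_sum (s := Finset.univ) (fun a _ => (h a).1)
    (fun a _ b _ hab => hind hab)
  have hmean' : ∫ ω, (∑ a, Z a) ω ∂P = 0 := by
    simp only [Finset.sum_apply]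
    rw [integral_finsetSum _ fun a _ => (h a).1.integrable (by norm_num)]
    simp [hmean]
  refine ⟨hfun ▸ hmem, ?_⟩
  rw [variance_of_integral_eq_zero hmem.aemeasurable hmean'] at hvar
  simp only [Finset.sum_apply] at hvar
  rw [hvar]
  refine Finset.sum_le_sum fun a _ => ?_
  rw [variance_of_integral_eq_zero (h a).1.aemeasurable (hmean a)]
  exact (h a).2

end HasSecondMomentLE

end SecondMoments

-- Independent sub-gaussian variables: moments, tails, and a bound on a subspace.

/-- An independent family of centred random variables, with sub-gaussian norm at most `κ`. -/
structure IsSubgaussianFamily {Ω J : Type*} [MeasurableSpace Ω] (P : Measure Ω)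
    (X : J → Ω → ℝ) (κ : ℝ) : Prop where
  aemeasurable : ∀ t, AEMeasurable (X t) P
  iIndepFun : iIndepFun X P
  integral_eq_zero : ∀ t, ∫ ω, X t ω ∂P = 0
  pos : 0 < κ
  lintegral_le : ∀ t, ∫⁻ ω, ENNReal.ofReal (Real.exp ((X t ω / κ) ^ 2)) ∂P ≤ 2

namespace IsSubgaussianFamily

variable {Ω J : Type*} [MeasurableSpace Ω] {P : Measure Ω} {X : J → Ω → ℝ} {κ : ℝ}

theorem precomp {J' : Type*} (h : IsSubgaussianFamily P X κ) {g : J' → J}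
    (hg : Function.Injective g) : IsSubgaussianFamily P (fun t => X (g t)) κ where
  aemeasurable t := h.aemeasurable (g t)
  iIndepFun := h.iIndepFun.precomp hg
  integral_eq_zero t := h.integral_eq_zero (g t)
  pos := h.pos
  lintegral_le t := h.lintegral_le (g t)

theorem integrable_exp_sq (h : IsSubgaussianFamily P X κ) (t : J) :
    Integrable (fun ω => Real.exp ((X t ω / κ) ^ 2)) P := by
  refine ⟨?_, ?_⟩
  · exact (Real.measurable_exp.comp_aemeasurable
      (((h.aemeasurable t).div_const κ).pow_const 2)).aestronglyMeasurable
  · rw [hasFiniteIntegral_iff_ofReal (Eventually.of_forall fun _ => (Real.exp_pos _).le)]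
    exact (h.lintegral_le t).trans_lt (by norm_num)

theorem integral_exp_sq_le (h : IsSubgaussianFamily P X κ) (t : J) :
    ∫ ω, Real.exp ((X t ω / κ) ^ 2) ∂P ≤ 2 := by
  rw [integral_eq_lintegral_of_nonneg_ae (Eventually.of_forall fun _ => (Real.exp_pos _).le)
    (h.integrable_exp_sq t).aestronglyMeasurable]
  exact ENNReal.toReal_le_of_le_ofReal (by norm_num) (by simpa using h.lintegral_le t)

theorem integral_pow_four_le (h : IsSubgaussianFamily P X κ) (t : J) :
    Integrable (fun ω => X t ω ^ 4) P ∧ ∫ ω, X t ω ^ 4 ∂P ≤ 4 * κ ^ 4 := by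
  have hκ := h.pos
  have hle : ∀ ω, X t ω ^ 4 ≤ 2 * κ ^ 4 * Real.exp ((X t ω / κ) ^ 2) := fun ω => by
    have h1 := Real.quadratic_le_exp_of_nonneg (sq_nonneg (X t ω / κ))
    have h2 : X t ω ^ 4 = κ ^ 4 * ((X t ω / κ) ^ 2) ^ 2 := by field_simp
    rw [h2, mul_comm 2, mul_assoc]
    refine mul_le_mul_of_nonneg_left ?_ (by positivity)
    nlinarith [sq_nonneg (X t ω / κ)]
  have hint := (h.integrable_exp_sq t).const_mul (2 * κ ^ 4)
  have hi : Integrable (fun ω => X t ω ^ 4) P := by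
    refine hint.mono' ((h.aemeasurable t).pow_const 4).aestronglyMeasurable
      (Eventually.of_forall fun ω => ?_)
    rw [Real.norm_of_nonneg (by positivity)]
    exact hle ω
  refine ⟨hi, (integral_mono hi hint hle).trans ?_⟩
  rw [integral_const_mul]
  have := h.integral_exp_sq_le t
  nlinarith [pow_pos hκ 4]

theorem hasSecondMomentLE_sq (h : IsSubgaussianFamily P X κ) (t : J) :
    HasSecondMomentLE P (fun ω => X t ω ^ 2) (4 * κ ^ 4) := by
  have h4 := h.integral_pow_four_le t
  have hsq : ∀ ω, (X t ω ^ 2) ^ 2 = X t ω ^ 4 := fun ω => by ring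
  refine ⟨(memLp_two_iff_integrable_sq
    ((h.aemeasurable t).pow_const 2).aestronglyMeasurable).2 ?_, ?_⟩
  · simpa only [hsq] using h4.1
  · simpa only [hsq] using h4.2

theorem hasSecondMomentLE_sum_sq {α : Type*} [Fintype α] (h : IsSubgaussianFamily P X κ) (g : α → J) :
    HasSecondMomentLE P (fun ω => ∑ k, X (g k) ω ^ 2) (4 * Fintype.card α ^ 2 * κ ^ 4) := by
  have hmem : MemLp (fun ω => ∑ k, X (g k) ω ^ 2) 2 P :=
    memLp_finsetSum _ fun k _ => (h.hasSecondMomentLE_sq (g k)).1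
  refine ⟨hmem, ?_⟩
  have hint : ∀ k, Integrable (fun ω => (X (g k) ω ^ 2) ^ 2) P := fun k =>
    (h.hasSecondMomentLE_sq (g k)).1.integrable_sq
  calc ∫ ω, (∑ k, X (g k) ω ^ 2) ^ 2 ∂P
      ≤ ∫ ω, Fintype.card α * ∑ k, (X (g k) ω ^ 2) ^ 2 ∂P := by
        refine integral_mono hmem.integrable_sq
          ((integrable_finsetSum _ fun k _ => hint k).const_mul _) fun ω => ?_
        exact sq_sum_le_card_mul_sum_sq
    _ = Fintype.card α * ∑ k, ∫ ω, (X (g k) ω ^ 2) ^ 2 ∂P := by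
        rw [integral_const_mul, integral_finsetSum _ fun k _ => hint k]
    _ ≤ Fintype.card α * ∑ _k : α, 4 * κ ^ 4 := by
        gcongr with k
        exact (h.hasSecondMomentLE_sq (g k)).2
    _ = 4 * Fintype.card α ^ 2 * κ ^ 4 := by
        simp
        ring

variable [IsProbabilityMeasure P]

theorem integral_sq_le (h : IsSubgaussianFamily P X κ) (t : J) :
    Integrable (fun ω => X t ω ^ 2) P ∧ ∫ ω, X t ω ^ 2 ∂P ≤ κ ^ 2 := by
  have hκ := h.pos
  have hle : ∀ ω, X t ω ^ 2 ≤ κ ^ 2 * (Real.exp ((X t ω / κ) ^ 2) - 1) := fun ω => by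
    have h1 := Real.add_one_le_exp ((X t ω / κ) ^ 2)
    have h2 : X t ω ^ 2 = κ ^ 2 * (X t ω / κ) ^ 2 := by field_simp
    rw [h2]
    exact mul_le_mul_of_nonneg_left (by linarith) (sq_nonneg _)
  have hint := ((h.integrable_exp_sq t).sub (integrable_const 1)).const_mul (κ ^ 2)
  have hi : Integrable (fun ω => X t ω ^ 2) P := by
    refine hint.mono' ((h.aemeasurable t).pow_const 2).aestronglyMeasurable
      (Eventually.of_forall fun ω => ?_)
    rw [Real.norm_of_nonneg (sq_nonneg _)]
    exact hle ω
  refine ⟨hi, (integral_mono hi hint hle).trans ?_⟩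
  simp only [Pi.sub_apply]
  rw [integral_const_mul, integral_sub (h.integrable_exp_sq t) (integrable_const 1)]
  have := h.integral_exp_sq_le t
  simp only [integral_const, probReal_univ, one_smul]
  nlinarith [sq_nonneg κ]

/-- If |zκ| ≤ 1, the inequality eˣ ≤ x + exp(x²) and centring remove the linear term. If |zκ| > 1,
Young's inequality zX ≤ (zκ)²/2 + (X/κ)²/2 gives at most 3/2 · exp((zκ)²/2), and 3/2 ≤ exp((zκ)²/2).
-/
theorem hasSubgaussianMGF (h : IsSubgaussianFamily P X κ) (t : J) :
    HasSubgaussianMGF (X t) (2 * κ ^ 2).toNNReal P := by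
  have hκ := h.pos
  have hintE := h.integrable_exp_sq t
  have hE := h.integral_exp_sq_le t
  have hdom1 : ∀ z ω, Real.exp (z * X t ω) ≤ Real.exp ((z * κ) ^ 2 / 2) *
      (1 / 2 + 1 / 2 * Real.exp ((X t ω / κ) ^ 2)) := fun z ω => by
    have h1 := exp_mul_le_of_mem_Icc (s := 1 / 2) (by norm_num) (by norm_num) ((X t ω / κ) ^ 2)
    have h2 : z * X t ω ≤ (z * κ) ^ 2 / 2 + 1 / 2 * (X t ω / κ) ^ 2 := by
      have : z * X t ω = (z * κ) * (X t ω / κ) := by field_simp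
      rw [this]
      nlinarith [sq_nonneg (z * κ - X t ω / κ)]
    calc Real.exp (z * X t ω) ≤ Real.exp ((z * κ) ^ 2 / 2) *
          Real.exp (1 / 2 * (X t ω / κ) ^ 2) := by
          rw [← Real.exp_add]; exact Real.exp_le_exp.2 h2
      _ ≤ _ := mul_le_mul_of_nonneg_left (by linarith) (Real.exp_pos _).le
  have hdomint : ∀ z : ℝ, Integrable (fun ω => Real.exp ((z * κ) ^ 2 / 2) *
      (1 / 2 + 1 / 2 * Real.exp ((X t ω / κ) ^ 2))) P := fun z =>
    ((integrable_const _).add (hintE.const_mul _)).const_mul _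
  have hint : ∀ z : ℝ, Integrable (fun ω => Real.exp (z * X t ω)) P := fun z => by
    refine (hdomint z).mono' (Real.measurable_exp.comp_aemeasurable
      ((h.aemeasurable t).const_mul z)).aestronglyMeasurable (Eventually.of_forall fun ω => ?_)
    rw [Real.norm_of_nonneg (Real.exp_pos _).le]
    exact hdom1 z ω
  refine ⟨hint, fun z => ?_⟩
  rw [Real.coe_toNNReal _ (by positivity),
    show 2 * κ ^ 2 * z ^ 2 / 2 = (z * κ) ^ 2 by ring, mgf]
  rcases le_or_gt ((z * κ) ^ 2) 1 with hs | hs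
  · have hX : Integrable (X t) P :=
      ((memLp_two_iff_integrable_sq (h.aemeasurable t).aestronglyMeasurable).2
        (h.integral_sq_le t).1).integrable (by norm_num)
    have hi1 : Integrable (fun ω => z * X t ω) P := hX.const_mul z
    have hi2 : Integrable (fun ω => 1 - (z * κ) ^ 2 +
        (z * κ) ^ 2 * Real.exp ((X t ω / κ) ^ 2)) P :=
      (integrable_const _).add (hintE.const_mul _)
    calc ∫ ω, Real.exp (z * X t ω) ∂P
        ≤ ∫ ω, (z * X t ω + (1 - (z * κ) ^ 2 +
            (z * κ) ^ 2 * Real.exp ((X t ω / κ) ^ 2))) ∂P := by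
          refine integral_mono (hint z) (hi1.add hi2) fun ω => ?_
          have h1 := exp_le_add_exp_sq (z * X t ω)
          have h2 := exp_mul_le_of_mem_Icc (sq_nonneg (z * κ)) hs ((X t ω / κ) ^ 2)
          have h3 : (z * κ) ^ 2 * (X t ω / κ) ^ 2 = (z * X t ω) ^ 2 := by field_simp
          rw [h3] at h2
          show Real.exp (z * X t ω) ≤ _
          linarith
      _ = 1 - (z * κ) ^ 2 + (z * κ) ^ 2 * ∫ ω, Real.exp ((X t ω / κ) ^ 2) ∂P := by
          rw [integral_add hi1 hi2, integral_const_mul, h.integral_eq_zero,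
            integral_add (integrable_const _) (hintE.const_mul _), integral_const_mul]
          simp
      _ ≤ (z * κ) ^ 2 + 1 := by nlinarith [sq_nonneg (z * κ)]
      _ ≤ Real.exp ((z * κ) ^ 2) := Real.add_one_le_exp _
  · calc ∫ ω, Real.exp (z * X t ω) ∂P
        ≤ ∫ ω, Real.exp ((z * κ) ^ 2 / 2) *
            (1 / 2 + 1 / 2 * Real.exp ((X t ω / κ) ^ 2)) ∂P :=
          integral_mono (hint z) (hdomint z) (hdom1 z)
      _ = Real.exp ((z * κ) ^ 2 / 2) *
            (1 / 2 + 1 / 2 * ∫ ω, Real.exp ((X t ω / κ) ^ 2) ∂P) := by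
          rw [integral_const_mul, integral_add (integrable_const _) (hintE.const_mul _),
            integral_const_mul]
          simp
      _ ≤ Real.exp ((z * κ) ^ 2 / 2) * Real.exp ((z * κ) ^ 2 / 2) := by
          refine mul_le_mul_of_nonneg_left ?_ (Real.exp_pos _).le
          have := Real.add_one_le_exp ((z * κ) ^ 2 / 2)
          linarith
      _ = Real.exp ((z * κ) ^ 2) := by rw [← Real.exp_add]; ring_nf

theorem hasSecondMomentLE (h : IsSubgaussianFamily P X κ) (t : J) :
    HasSecondMomentLE P (X t) (κ ^ 2) :=
  ⟨(memLp_two_iff_integrable_sq (h.aemeasurable t).aestronglyMeasurable).2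
    (h.integral_sq_le t).1, (h.integral_sq_le t).2⟩

theorem hasSecondMomentLE_mul (h : IsSubgaussianFamily P X κ) {s t : J} (hst : s ≠ t) :
    HasSecondMomentLE P (fun ω => X s ω * X t ω) (κ ^ 4) := by
  have hind : IndepFun (fun ω => X s ω ^ 2) (fun ω => X t ω ^ 2) P :=
    (h.iIndepFun.indepFun hst).comp (φ := fun x : ℝ => x ^ 2) (ψ := fun x : ℝ => x ^ 2)
      (measurable_id.pow_const 2) (measurable_id.pow_const 2)
  have hint := hind.integrable_mul (h.integral_sq_le s).1 (h.integral_sq_le t).1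
  have hsq : ∀ ω, (X s ω * X t ω) ^ 2 = X s ω ^ 2 * X t ω ^ 2 := fun ω => mul_pow _ _ _
  refine ⟨(memLp_two_iff_integrable_sq
    ((h.aemeasurable s).mul (h.aemeasurable t)).aestronglyMeasurable).2 ?_, ?_⟩
  · exact hint.congr (Eventually.of_forall fun ω => (hsq ω).symm)
  · simp_rw [hsq]
    rw [hind.integral_fun_mul_eq_mul_integral (h.integral_sq_le s).1.aestronglyMeasurable
      (h.integral_sq_le t).1.aestronglyMeasurable]
    calc _ ≤ κ ^ 2 * κ ^ 2 := mul_le_mul (h.integral_sq_le s).2 (h.integral_sq_le t).2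
          (integral_nonneg fun _ => sq_nonneg _) (sq_nonneg _)
      _ = κ ^ 4 := by ring

variable {α : Type*} [Fintype α]

theorem hasSecondMomentLE_sum_mul (h : IsSubgaussianFamily P X κ) {g : α → J}
    (hg : Function.Injective g) (a : α → ℝ) :
    HasSecondMomentLE P (fun ω => ∑ k, a k * X (g k) ω) (κ ^ 2 * ∑ k, a k ^ 2) := by
  refine (HasSecondMomentLE.sum_of_pairwise_indepFun
    (fun k => (h.hasSecondMomentLE (g k)).const_mul (a k)) (fun k => ?_)
    (fun k k' hkk' => ?_)).mono (le_of_eq ?_)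
  · rw [integral_const_mul, h.integral_eq_zero, mul_zero]
  · exact (h.iIndepFun.indepFun (hg.ne hkk')).comp (measurable_const_mul _)
      (measurable_const_mul _)
  · rw [Finset.mul_sum]
    exact Finset.sum_congr rfl fun k _ => mul_comm _ _

/-- The products use disjoint pairs of variables, so they are centred and pairwise independent and
their variances add. -/
theorem hasSecondMomentLE_sum_mul_mul (h : IsSubgaussianFamily P X κ) {g g' : α → J}
    (hg : Function.Injective g) (hg' : Function.Injective g') (hgg' : ∀ k k', g k ≠ g' k') :
    HasSecondMomentLE P (fun ω => ∑ k, X (g k) ω * X (g' k) ω) (Fintype.card α * κ ^ 4) := by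
  refine (HasSecondMomentLE.sum_of_pairwise_indepFun
    (fun k => h.hasSecondMomentLE_mul (hgg' k k)) (fun k => ?_)
    (fun k k' hkk' => ?_)).mono (le_of_eq ?_)
  · rw [(h.iIndepFun.indepFun (hgg' k k)).integral_fun_mul_eq_mul_integral
      (h.aemeasurable _).aestronglyMeasurable (h.aemeasurable _).aestronglyMeasurable,
      h.integral_eq_zero, zero_mul]
  · exact h.iIndepFun.indepFun_mul_mul₀ h.aemeasurable _ _ _ _ (hg.ne hkk') (hgg' _ _)
      (hgg' _ _).symm (hg'.ne hkk')
  · simp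

theorem hasSecondMomentLE_sum_add_mul (h : IsSubgaussianFamily P X κ) {g g' : α → J}
    (hg : Function.Injective g) (hg' : Function.Injective g') (hgg' : ∀ k k', g k ≠ g' k')
    {a : α → ℝ} (ha : ∀ k, |a k| ≤ 1) :
    HasSecondMomentLE P (fun ω => ∑ k, (a k + X (g k) ω) * X (g' k) ω)
      (2 * κ ^ 2 * (1 + κ ^ 2) * Fintype.card α) := by
  have h1 := (h.hasSecondMomentLE_sum_mul hg' a).add (h.hasSecondMomentLE_sum_mul_mul hg hg' hgg')
  simp_rw [add_mul, Finset.sum_add_distrib]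
  refine h1.mono ?_
  have h2 : ∑ k, a k ^ 2 ≤ Fintype.card α := by
    refine (Finset.sum_le_sum fun k _ => (sq_le_one_iff_abs_le_one _).2 (ha k)).trans ?_
    simp
  nlinarith [mul_le_mul_of_nonneg_left h2 (sq_nonneg κ)]

theorem measure_abs_sum_mul_ge_le (h : IsSubgaussianFamily P X κ) {g : α → J}
    (hg : Function.Injective g) {a : α → ℝ} (ha : ∑ k, a k ^ 2 = 1) {ε : ℝ} (hε : 0 ≤ ε) :
    P {ω | ε ≤ |∑ k, a k * X (g k) ω|} ≤
      ENNReal.ofReal (2 * Real.exp (-ε ^ 2 / (4 * κ ^ 2))) := by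
  have hsub : HasSubgaussianMGF (fun ω => ∑ k, a k * X (g k) ω) (2 * κ ^ 2).toNNReal P := by
    have h1 := HasSubgaussianMGF.sum_of_iIndepFun (s := Finset.univ)
      (X := fun k ω => a k * X (g k) ω)
      ((h.iIndepFun.precomp hg).comp (fun k x => a k * x) fun k => measurable_const_mul _)
      (fun k _ => (h.hasSubgaussianMGF (g k)).const_mul (a k))
    convert h1 using 1
    rw [← NNReal.coe_inj, NNReal.coe_sum]
    show _ = ∑ k, a k ^ 2 * (((2 * κ ^ 2).toNNReal : ℝ≥0) : ℝ)
    rw [← Finset.sum_mul, ha, one_mul]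
  have htail : ∀ {Z : Ω → ℝ}, HasSubgaussianMGF Z (2 * κ ^ 2).toNNReal P →
      P {ω | ε ≤ Z ω} ≤ ENNReal.ofReal (Real.exp (-ε ^ 2 / (4 * κ ^ 2))) := fun hZ => by
    have := hZ.measure_ge_le hε
    rw [Real.coe_toNNReal _ (by positivity), ← mul_assoc] at this
    norm_num at this
    rw [← ofReal_measureReal]
    exact ENNReal.ofReal_le_ofReal this
  have hunion : {ω | ε ≤ |∑ k, a k * X (g k) ω|} ⊆
      {ω | ε ≤ ∑ k, a k * X (g k) ω} ∪ {ω | ε ≤ (-fun ω => ∑ k, a k * X (g k) ω) ω} :=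
    fun ω hω => by simpa [le_abs] using hω
  refine (measure_mono hunion).trans ((measure_union_le _ _).trans ?_)
  refine (add_le_add (htail hsub) (htail hsub.neg)).trans_eq ?_
  rw [← ENNReal.ofReal_add (Real.exp_pos _).le (Real.exp_pos _).le, two_mul]

/-- With high probability, a random matrix is small on a subspace of small dimension. -/
theorem exists_measure_le_forall_mem_sum_sq_le (h : IsSubgaussianFamily P X κ) {β : Type*}
    [Fintype β] {g : α → β → J} (hg : ∀ b, Function.Injective fun a => g a b)
    (W : Submodule ℝ (EuclideanSpace ℝ α)) {δ : ℝ} (hδ : 0 ≤ δ) :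
    ∃ bad : Set Ω, P bad ≤ ENNReal.ofReal (Module.finrank ℝ W * Fintype.card β *
        (2 * Real.exp (-(δ ^ 2 / (Module.finrank ℝ W * Fintype.card β)) / (4 * κ ^ 2)))) ∧
      ∀ ω ∉ bad, ∀ x ∈ W, ∑ b, (∑ a, X (g a b) ω * x a) ^ 2 ≤ δ ^ 2 * ‖x‖ ^ 2 := by
  set r := Module.finrank ℝ W
  set p := Fintype.card β
  set w := stdOrthonormalBasis ℝ W
  -- If the `r * p` coordinates of the noise on a basis of `W` are all below `ε`, Cauchy–Schwarz
  -- gives the total `r * p * ε ^ 2 = δ ^ 2`. For `r * p = 0` the quotient is `0` and the union of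
  -- events is empty.
  set ε := δ / √(r * p) with hε
  have hε0 : 0 ≤ ε := by positivity
  have hεsq : ε ^ 2 = δ ^ 2 / (r * p) := by
    rw [hε, div_pow, Real.sq_sqrt (by positivity)]
  have hw : ∀ l, ∑ a, (w l : EuclideanSpace ℝ α) a ^ 2 = 1 := fun l => by
    rw [← euclidean_norm_sq, ← Submodule.coe_norm, w.norm_eq_one, one_pow]
  refine ⟨⋃ l, ⋃ b, {ω | ε ≤ |∑ a, (w l : EuclideanSpace ℝ α) a * X (g a b) ω|}, ?_, ?_⟩
  · calc P (⋃ l, ⋃ b, {ω | ε ≤ |∑ a, (w l : EuclideanSpace ℝ α) a * X (g a b) ω|})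
        ≤ ∑ _l : Fin r, ∑ _b : β, ENNReal.ofReal (2 * Real.exp (-ε ^ 2 / (4 * κ ^ 2))) := by
          refine (measure_iUnion_fintype_le _ _).trans (Finset.sum_le_sum fun l _ => ?_)
          refine (measure_iUnion_fintype_le _ _).trans (Finset.sum_le_sum fun b _ => ?_)
          exact h.measure_abs_sum_mul_ge_le (hg b) (hw l) hε0
      _ = _ := by
          rw [hεsq]
          simp only [Finset.sum_const, Finset.card_univ, Fintype.card_fin, nsmul_eq_mul]
          rw [ENNReal.ofReal_mul (p := r * p) (by positivity),
            ENNReal.ofReal_mul (p := r) (by positivity), ENNReal.ofReal_natCast, ENNReal.ofReal_natCast, mul_assoc]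
  · intro ω hω x hx
    simp only [Set.mem_iUnion, Set.mem_ofPred_eq, not_exists, not_le] at hω
    set z : Fin r → β → ℝ := fun l b => ∑ a, (w l : EuclideanSpace ℝ α) a * X (g a b) ω
    set co : Fin r → ℝ := fun l => ⟪w l, ⟨x, hx⟩⟫
    have hx' : ∀ a, x a = ∑ l, co l * (w l : EuclideanSpace ℝ α) a := fun a => by
      have h1 := congrArg Subtype.val (w.sum_repr' ⟨x, hx⟩)
      have h2 := congrArg (fun y : EuclideanSpace ℝ α => y a) h1
      simp only [Submodule.coe_sum, Submodule.coe_smul, WithLp.ofLp_sum, WithLp.ofLp_smul,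
        Finset.sum_apply, Pi.smul_apply, smul_eq_mul] at h2
      exact h2.symm
    have hco : ∑ l, co l ^ 2 = ‖x‖ ^ 2 := by
      have := w.sum_sq_norm_inner_right ⟨x, hx⟩
      simpa [co, sq_abs] using this
    have hsum : ∀ b, ∑ a, X (g a b) ω * x a = ∑ l, co l * z l b := fun b => by
      simp only [z, hx', Finset.mul_sum]
      rw [Finset.sum_comm]
      exact Finset.sum_congr rfl fun l _ => Finset.sum_congr rfl fun a _ => by ring
    calc ∑ b, (∑ a, X (g a b) ω * x a) ^ 2
        ≤ ∑ _b : β, ‖x‖ ^ 2 * (r * ε ^ 2) := by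
          refine Finset.sum_le_sum fun b _ => ?_
          rw [hsum b, ← hco]
          refine (Finset.sum_mul_sq_le_sq_mul_sq _ _ _).trans ?_
          refine mul_le_mul_of_nonneg_left ?_ (Finset.sum_nonneg fun _ _ => sq_nonneg _)
          refine (Finset.sum_le_sum (g := fun _ => ε ^ 2) fun l _ => ?_).trans ?_
          · rw [← sq_abs]
            exact pow_le_pow_left₀ (abs_nonneg _) (hω l b).le 2
          · simp
      _ = (r * p) * (δ ^ 2 / (r * p)) * ‖x‖ ^ 2 := by
          rw [hεsq, Finset.sum_const, Finset.card_univ, nsmul_eq_mul]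
          ring
      _ ≤ δ ^ 2 * ‖x‖ ^ 2 := by
          refine mul_le_mul_of_nonneg_right ?_ (sq_nonneg _)
          rcases eq_or_ne ((r : ℝ) * p) 0 with h0 | h0
          · rw [h0, zero_mul]
            exact sq_nonneg δ
          · rw [mul_div_cancel₀ _ h0]

end IsSubgaussianFamily

/-- One term of the exponential series suffices. Taken at `k = 20`, it turns the exponential tail
into the tenth powers of both dimensions. -/
theorem mul_exp_neg_mul_le {h x : ℝ} (hh : 0 < h) (hx : 0 < x) (k : ℕ) :
    x * Real.exp (-(h * x)) ≤ (k + 1).factorial / h ^ (k + 1) / x ^ k := by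
  have h1 := Real.pow_div_factorial_le_exp (h * x) (by positivity) (k + 1)
  have hf : (0 : ℝ) < (k + 1).factorial := by exact_mod_cast Nat.factorial_pos _
  rw [Real.exp_neg, div_div, ← div_eq_mul_inv, div_le_div_iff₀ (Real.exp_pos _) (by positivity)]
  rw [div_le_iff₀ hf, mul_pow] at h1
  calc x * (h ^ (k + 1) * x ^ k) = h ^ (k + 1) * x ^ (k + 1) := by ring
    _ ≤ _ := by linarith

-- The estimation error on one subgroup.

section Subgroup

variable {Ω ι γ : Type*}

/-- The noise matrix of a family of noise variables indexed by the entries of the anchor matrix,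
of the target row and of the target column. -/
def noiseMatrix (X : (ι × γ) ⊕ (γ ⊕ ι) → Ω → ℝ) (ω : Ω) : Matrix ι γ ℝ :=
  fun a b => X (Sum.inl (a, b)) ω

/-- The noise vector of the target row. -/
def rowNoise (X : (ι × γ) ⊕ (γ ⊕ ι) → Ω → ℝ) (ω : Ω) : EuclideanSpace ℝ γ :=
  WithLp.toLp 2 fun b => X (Sum.inr (Sum.inl b)) ω

/-- The noise vector of the target column. -/
def colNoise (X : (ι × γ) ⊕ (γ ⊕ ι) → Ω → ℝ) (ω : Ω) : EuclideanSpace ℝ ι :=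
  WithLp.toLp 2 fun a => X (Sum.inr (Sum.inr a)) ω

variable [MeasurableSpace Ω] [Fintype ι] [Fintype γ]

variable {P : Measure Ω} [IsProbabilityMeasure P] {X : (ι × γ) ⊕ (γ ⊕ ι) → Ω → ℝ} {κ : ℝ}

theorem hasSecondMomentLE_norm_colNoise {ι γ : Type*} [Fintype ι]
    {X : (ι × γ) ⊕ (γ ⊕ ι) → Ω → ℝ} (h : IsSubgaussianFamily P X κ) :
    HasSecondMomentLE P (fun ω => ‖colNoise X ω‖) (Fintype.card ι * κ ^ 2) := by
  simp_rw [euclidean_norm_eq]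
  refine (HasSecondMomentLE.sqrt_sum fun a =>
    h.hasSecondMomentLE (Sum.inr (Sum.inr a))).mono ?_
  simp

/-- Off the diagonal, an entry of ΔΔᵀ is a sum of |γ| uncorrelated centred products; only the |ι|
diagonal entries are as large as |γ|. The resulting bound on ‖Δ‖² is not sharp, but it fits the
claimed error. -/
theorem hasSecondMomentLE_gram [DecidableEq ι] (h : IsSubgaussianFamily P X κ) :
    HasSecondMomentLE P
      (fun ω => √(∑ a, ∑ a', (∑ b, noiseMatrix X ω a b * noiseMatrix X ω a' b) ^ 2))
      (4 * κ ^ 4 * (Fintype.card ι * Fintype.card γ * (Fintype.card ι + Fintype.card γ))) := by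
  have hent : ∀ q : ι × ι, HasSecondMomentLE P
      (fun ω => ∑ b, noiseMatrix X ω q.1 b * noiseMatrix X ω q.2 b)
      (Fintype.card γ * κ ^ 4 + if q.1 = q.2 then 4 * Fintype.card γ ^ 2 * κ ^ 4 else 0) := by
    rintro ⟨a, a'⟩
    rcases eq_or_ne a a' with rfl | haa'
    · simp only [noiseMatrix, ← sq, if_true]
      refine (h.hasSecondMomentLE_sum_sq fun b => Sum.inl (a, b)).mono ?_
      have : 0 ≤ (Fintype.card γ : ℝ) * κ ^ 4 := by positivity
      linarith
    · simp only [if_neg haa', add_zero]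
      exact h.hasSecondMomentLE_sum_mul_mul (g := fun b => Sum.inl (a, b))
        (g' := fun b => Sum.inl (a', b)) (fun b b' hb => by simpa using hb)
        (fun b b' hb => by simpa using hb) (fun b b' hb => haa' (by simp_all))
  have h1 := HasSecondMomentLE.sqrt_sum hent
  simp_rw [Fintype.sum_prod_type] at h1
  refine h1.mono ?_
  simp only [Finset.sum_add_distrib, Finset.sum_const, Finset.card_univ, nsmul_eq_mul,
    Finset.sum_ite_eq, Finset.mem_univ, if_true]
  have : 0 ≤ (Fintype.card ι : ℝ) * Fintype.card ι * Fintype.card γ * κ ^ 4 := by positivity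
  nlinarith

variable [DecidableEq γ] {T : Matrix ι γ ℝ}

/-- Each coordinate is a linear form in η plus a sum of uncorrelated products, of variance O(|γ|).
The squared norm is thus O(|ι||γ|) in mean, a factor |γ| below ‖T + Δ‖²‖η‖². -/
theorem hasSecondMomentLE_norm_apply_rowNoise (h : IsSubgaussianFamily P X κ)
    (hT : ∀ a b, |T a b| ≤ 1) :
    HasSecondMomentLE P
      (fun ω => ‖(T.toEuclideanLin + (noiseMatrix X ω).toEuclideanLin) (rowNoise X ω)‖)
      (2 * κ ^ 2 * (1 + κ ^ 2) * (Fintype.card ι * Fintype.card γ)) := by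
  simp_rw [← map_add, euclidean_norm_eq, toEuclideanLin_apply_apply]
  refine (HasSecondMomentLE.sqrt_sum fun a => h.hasSecondMomentLE_sum_add_mul
    (g := fun b => Sum.inl (a, b)) (g' := fun b => Sum.inr (Sum.inl b))
    (fun b b' hb => by simpa using hb) (fun b b' hb => by simpa using hb)
    (fun b b' hb => by simp at hb) (hT a)).mono (le_of_eq ?_)
  simp
  ring

variable [DecidableEq ι]

theorem hasSecondMomentLE_norm_adjoint_colNoise (h : IsSubgaussianFamily P X κ)
    (hT : ∀ a b, |T a b| ≤ 1) :
    HasSecondMomentLE P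
      (fun ω => ‖LinearMap.adjoint (T.toEuclideanLin + (noiseMatrix X ω).toEuclideanLin)
        (colNoise X ω)‖)
      (2 * κ ^ 2 * (1 + κ ^ 2) * (Fintype.card ι * Fintype.card γ)) := by
  simp_rw [← map_add Matrix.toEuclideanLin, euclidean_norm_eq, adjoint_toEuclideanLin_apply]
  refine (HasSecondMomentLE.sqrt_sum fun b => h.hasSecondMomentLE_sum_add_mul
    (g := fun a => Sum.inl (a, b)) (g' := fun a => Sum.inr (Sum.inr a))
    (fun b b' hb => by simpa using hb) (fun b b' hb => by simpa using hb)
    (fun b b' hb => by simp at hb) (fun a => hT a b)).mono (le_of_eq ?_)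
  simp
  ring

theorem hasSecondMomentLE_norm_adjoint_noiseMatrix (h : IsSubgaussianFamily P X κ)
    (β : EuclideanSpace ℝ ι) :
    HasSecondMomentLE P
      (fun ω => ‖LinearMap.adjoint (noiseMatrix X ω).toEuclideanLin β‖)
      (Fintype.card γ * (κ ^ 2 * ‖β‖ ^ 2)) := by
  have h1 := HasSecondMomentLE.sqrt_sum fun b => h.hasSecondMomentLE_sum_mul
    (g := fun a => Sum.inl (a, b)) (fun b b' hb => by simpa using hb) β
  simp_rw [euclidean_norm_eq (LinearMap.adjoint _ _), adjoint_toEuclideanLin_apply, noiseMatrix,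
    mul_comm (X _ _) (β _)]
  refine h1.mono (le_of_eq ?_)
  simp [euclidean_norm_sq]

/-- The random bound on the estimation error on a subgroup. -/
noncomputable def errorBound (T : Matrix ι γ ℝ) (X : (ι × γ) ⊕ (γ ⊕ ι) → Ω → ℝ) (θ : ℝ)
    (β : EuclideanSpace ℝ ι) (ω : Ω) : ℝ :=
  4 / θ ^ 2 * √(Fintype.card ι) * ‖β‖ *
      √(∑ a, ∑ a', (∑ b, noiseMatrix X ω a b * noiseMatrix X ω a' b) ^ 2) +
    2 / θ * ‖β‖ * ‖LinearMap.adjoint (T.toEuclideanLin + (noiseMatrix X ω).toEuclideanLin)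
        (colNoise X ω)‖ +
    (4 / θ ^ 2 * ((√(Fintype.card ι) + ‖colNoise X ω‖) *
        ‖(T.toEuclideanLin + (noiseMatrix X ω).toEuclideanLin) (rowNoise X ω)‖) +
      2 / θ * ((√(Fintype.card ι) + ‖colNoise X ω‖) *
        ‖LinearMap.adjoint (noiseMatrix X ω).toEuclideanLin β‖))

theorem integrable_errorBound_and_integral_le (h : IsSubgaussianFamily P X κ)
    (hT : ∀ a b, |T a b| ≤ 1) {θ : ℝ} (hθ : 0 < θ) (β : EuclideanSpace ℝ ι) :
    Integrable (errorBound T X θ β) P ∧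
      ∫ ω, errorBound T X θ β ω ∂P ≤
        8 * (1 + κ ^ 2) ^ 2 * (√(Fintype.card ι) * (√(Fintype.card ι) * √(Fintype.card γ)) *
            ((√(Fintype.card ι) + √(Fintype.card γ)) * ‖β‖ + 1) / θ ^ 2 +
          √(Fintype.card ι) * √(Fintype.card γ) * ‖β‖ / θ) := by
  set A := √(Fintype.card ι) with hA
  set B := √(Fintype.card γ) with hB
  have hA0 : 0 ≤ A := Real.sqrt_nonneg _
  have hB0 : 0 ≤ B := Real.sqrt_nonneg _
  have hAsq : A ^ 2 = Fintype.card ι := Real.sq_sqrt (Nat.cast_nonneg _)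
  have hBsq : B ^ 2 = Fintype.card γ := Real.sq_sqrt (Nat.cast_nonneg _)
  set L := 1 + κ ^ 2 with hL
  have hκL : κ ^ 2 ≤ L := by linarith
  have hκL2 : κ ^ 2 ≤ L ^ 2 := by nlinarith [sq_nonneg κ]
  have hL1 : 1 ≤ L := by nlinarith [sq_nonneg κ]
  have hLL : L ≤ L ^ 2 := by nlinarith
  have m1 := hasSecondMomentLE_gram h
  have m2 := hasSecondMomentLE_norm_adjoint_colNoise h hT
  have m3 := hasSecondMomentLE_norm_apply_rowNoise h hT
  have m4 := hasSecondMomentLE_norm_adjoint_noiseMatrix h β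
  have m5 := (HasSecondMomentLE.const (P := P) A).add (hasSecondMomentLE_norm_colNoise h)
  have i1 := m1.integral_le
  have i2 := m2.integral_le
  have i3 := m5.integrable_mul m3
  have i3' := m5.integral_mul_le m3
  have i4 := m5.integrable_mul m4
  have i4' := m5.integral_mul_le m4
  rw [← hAsq, ← hBsq] at i1 i2 i3' i4'
  -- The constants are coarsened so that each of `b1` to `b4` carries `2 * L ^ 2`; the terms then
  -- add up with the common factor `8 * L ^ 2`.
  have b1 : √(4 * κ ^ 4 * (A ^ 2 * B ^ 2 * (A ^ 2 + B ^ 2))) ≤ 2 * L ^ 2 * (A * B * (A + B)) := by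
    refine Real.sqrt_le_iff.2 ⟨by positivity, ?_⟩
    have e1 : κ ^ 4 ≤ (L ^ 2) ^ 2 := by
      calc κ ^ 4 = (κ ^ 2) ^ 2 := by ring
        _ ≤ (L ^ 2) ^ 2 := pow_le_pow_left₀ (sq_nonneg _) (hκL.trans hLL) 2
    have e2 : A ^ 2 + B ^ 2 ≤ (A + B) ^ 2 := by nlinarith [mul_nonneg hA0 hB0]
    calc 4 * κ ^ 4 * (A ^ 2 * B ^ 2 * (A ^ 2 + B ^ 2))
        ≤ 4 * (L ^ 2) ^ 2 * (A ^ 2 * B ^ 2 * (A + B) ^ 2) := by gcongr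
      _ = _ := by ring
  have b2 : √(2 * κ ^ 2 * L * (A ^ 2 * B ^ 2)) ≤ 2 * L ^ 2 * (A * B) := by
    refine Real.sqrt_le_iff.2 ⟨by positivity, ?_⟩
    calc 2 * κ ^ 2 * L * (A ^ 2 * B ^ 2) ≤ 4 * L ^ 2 * L ^ 2 * (A ^ 2 * B ^ 2) := by
          gcongr
          norm_num
      _ = _ := by ring
  have b3 : √((2 * A ^ 2 + 2 * (A ^ 2 * κ ^ 2)) * (2 * κ ^ 2 * L * (A ^ 2 * B ^ 2))) ≤
      2 * L ^ 2 * (A * (A * B)) := by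
    refine Real.sqrt_le_iff.2 ⟨by positivity, ?_⟩
    calc (2 * A ^ 2 + 2 * (A ^ 2 * κ ^ 2)) * (2 * κ ^ 2 * L * (A ^ 2 * B ^ 2))
        = 4 * (L ^ 2 * κ ^ 2) * (A ^ 2 * (A ^ 2 * B ^ 2)) := by rw [hL]; ring
      _ ≤ 4 * (L ^ 2 * L ^ 2) * (A ^ 2 * (A ^ 2 * B ^ 2)) := by
          gcongr
      _ = _ := by ring
  have b4 : √((2 * A ^ 2 + 2 * (A ^ 2 * κ ^ 2)) * (B ^ 2 * (κ ^ 2 * ‖β‖ ^ 2))) ≤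
      2 * L ^ 2 * (A * B * ‖β‖) := by
    refine Real.sqrt_le_iff.2 ⟨by positivity, ?_⟩
    calc (2 * A ^ 2 + 2 * (A ^ 2 * κ ^ 2)) * (B ^ 2 * (κ ^ 2 * ‖β‖ ^ 2))
        = 2 * (L * κ ^ 2) * (A ^ 2 * (B ^ 2 * ‖β‖ ^ 2)) := by rw [hL]; ring
      _ ≤ 4 * (L ^ 2 * L ^ 2) * (A ^ 2 * (B ^ 2 * ‖β‖ ^ 2)) := by
          gcongr
          norm_num
      _ = _ := by ring
  have j1 := i1.1.const_mul (4 / θ ^ 2 * A * ‖β‖)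
  have j2 := i2.1.const_mul (2 / θ * ‖β‖)
  have j3 := i3.const_mul (4 / θ ^ 2)
  have j4 := i4.const_mul (2 / θ)
  refine ⟨(j1.add j2).add (j3.add j4), ?_⟩
  have hsplit : ∫ ω, errorBound T X θ β ω ∂P =
      4 / θ ^ 2 * A * ‖β‖ *
        ∫ ω, √(∑ a, ∑ a', (∑ b, noiseMatrix X ω a b * noiseMatrix X ω a' b) ^ 2) ∂P +
      2 / θ * ‖β‖ * ∫ ω, ‖LinearMap.adjoint
        (T.toEuclideanLin + (noiseMatrix X ω).toEuclideanLin) (colNoise X ω)‖ ∂P +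
      (4 / θ ^ 2 * ∫ ω, (A + ‖colNoise X ω‖) *
        ‖(T.toEuclideanLin + (noiseMatrix X ω).toEuclideanLin) (rowNoise X ω)‖ ∂P +
      2 / θ * ∫ ω, (A + ‖colNoise X ω‖) *
        ‖LinearMap.adjoint (noiseMatrix X ω).toEuclideanLin β‖ ∂P) := by
    simp_rw [← integral_const_mul]
    rw [← integral_add j1 j2, ← integral_add j3 j4]
    exact integral_add (j1.add j2) (j3.add j4)
  rw [hsplit]
  calc _ ≤ 4 / θ ^ 2 * A * ‖β‖ * (2 * L ^ 2 * (A * B * (A + B))) +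
        2 / θ * ‖β‖ * (2 * L ^ 2 * (A * B)) +
        (4 / θ ^ 2 * (2 * L ^ 2 * (A * (A * B))) + 2 / θ * (2 * L ^ 2 * (A * B * ‖β‖))) := by
        gcongr
        · exact i1.2.trans b1
        · exact i2.2.trans b2
        · exact i3'.trans b3
        · exact i4'.trans b4
    _ = _ := by ring

/-- The deterministic estimate at t = θ/2, with ν² the Frobenius norm of ΔΔᵀ and ‖x₀‖ at most the
root of the number of rows. -/
theorem abs_estimate_sub_le_errorBound {Ω : Type*} {X : (ι × γ) ⊕ (γ ⊕ ι) → Ω → ℝ} {θ : ℝ}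
    (hθ : θ = T.toEuclideanLin.singularValues (T.rank - 1)) (hθ0 : 0 < θ)
    {x₀ β : EuclideanSpace ℝ ι} (hx₀ : x₀ ∈ LinearMap.range T.toEuclideanLin)
    (hx₀' : ‖x₀‖ ≤ √(Fintype.card ι)) (hβ : β ∈ LinearMap.range T.toEuclideanLin) {ω : Ω}
    (hsmall : (∀ y ∈ (LinearMap.ker T.toEuclideanLin)ᗮ,
        ‖(noiseMatrix X ω).toEuclideanLin y‖ ≤ θ / 2 * ‖y‖) ∨
      ∀ x ∈ LinearMap.range T.toEuclideanLin,
        ‖LinearMap.adjoint (noiseMatrix X ω).toEuclideanLin x‖ ≤ θ / 2 * ‖x‖)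
    {est : ℝ} (hest : IsTruncatedSVDEstimate (T + noiseMatrix X ω)
      (LinearMap.adjoint T.toEuclideanLin β + rowNoise X ω).ofLp (x₀ + colNoise X ω).ofLp
      T.rank est) :
    |est - ⟪x₀, β⟫| ≤ errorBound T X θ β ω := by
  obtain ⟨τ, u, v, hsvd, rfl⟩ := hest
  have hs := hsvd.hasSVD
  rw [map_add] at hs
  rw [rank_eq_finrank_range_toEuclideanLin] at hθ ⊢
  have h1 := abs_truncInv_estimate_sub_le hs hθ0 (half_pos hθ0)
    (Real.sqrt_nonneg √(∑ a, ∑ a', (∑ b, noiseMatrix X ω a b * noiseMatrix X ω a' b) ^ 2))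
    (fun x hx => by rw [hθ]; exact exists_preimage_singularValues_mul_norm_le _ hx)
    (fun l hl => hs.half_le_singularValue hθ hsmall l hl)
    (fun y => le_of_sq_le_sq (by
      rw [mul_pow, Real.sq_sqrt (Real.sqrt_nonneg _)]
      exact norm_sq_toEuclideanLin_le _ y) (by positivity)) hx₀ hβ (colNoise X ω) (rowNoise X ω)
  rw [dotProduct_truncInv]
  refine h1.trans ?_
  rw [Real.sq_sqrt (Real.sqrt_nonneg _)]
  unfold errorBound
  calc _ ≤ 4 * √(∑ a, ∑ a', (∑ b, noiseMatrix X ω a b * noiseMatrix X ω a' b) ^ 2) / θ ^ 2 *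
        √(Fintype.card ι) * ‖β‖ +
        ‖LinearMap.adjoint (T.toEuclideanLin + (noiseMatrix X ω).toEuclideanLin)
          (colNoise X ω)‖ * ‖β‖ / (θ / 2) +
        (√(Fintype.card ι) + ‖colNoise X ω‖) *
          (‖(T.toEuclideanLin + (noiseMatrix X ω).toEuclideanLin) (rowNoise X ω)‖ / (θ / 2) ^ 2 +
          ‖LinearMap.adjoint (noiseMatrix X ω).toEuclideanLin β‖ / (θ / 2)) := by gcongr
    _ = _ := by
        field_simp
        ring

/-- The noise is tested on a subspace of vectors indexed by the longer side, so the union runs over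
the shorter side only. The threshold for one coordinate is then at least of order √(longer side)/r,
which makes the tail exponential in the longer side. -/
theorem exists_measure_le_forall_notMem_small (h : IsSubgaussianFamily P X κ) {μ : ℕ} {g θ : ℝ}
    (hg : 0 < g) (hι : 0 < Fintype.card ι) (hγ : 0 < Fintype.card γ) (hr : 0 < T.rank)
    (hrμ : T.rank ≤ μ) (hθ0 : 0 < θ)
    (hθ : g ^ 2 * (Fintype.card ι * Fintype.card γ) ≤ T.rank * θ ^ 2) :
    ∃ bad : Set Ω, P bad ≤ ENNReal.ofReal (2 * μ * ((20 + 1).factorial /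
        (g ^ 2 / (16 * κ ^ 2 * μ ^ 2)) ^ (20 + 1)) /
          (Fintype.card γ ^ 10 * Fintype.card ι ^ 10)) ∧
      ∀ ω ∉ bad, (∀ y ∈ (LinearMap.ker T.toEuclideanLin)ᗮ,
        ‖(noiseMatrix X ω).toEuclideanLin y‖ ≤ θ / 2 * ‖y‖) ∨
      ∀ x ∈ LinearMap.range T.toEuclideanLin,
        ‖LinearMap.adjoint (noiseMatrix X ω).toEuclideanLin x‖ ≤ θ / 2 * ‖x‖ := by
  have hκ := h.pos
  have hμ : (0 : ℝ) < μ := by exact_mod_cast hr.trans_le hrμ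
  have hr' : (0 : ℝ) < T.rank := by exact_mod_cast hr
  have hrμ' : (T.rank : ℝ) ≤ μ := by exact_mod_cast hrμ
  have hh : 0 < g ^ 2 / (16 * κ ^ 2 * μ ^ 2) := by positivity
  -- Here `x` is the longer side and `y` the shorter one, so `y ^ 10 * x ^ 10 ≤ x ^ 20`.
  have tail : ∀ x y : ℝ, 0 < y → y ≤ x → g ^ 2 * (x * y) ≤ T.rank * θ ^ 2 →
      T.rank * y * (2 * Real.exp (-((θ / 2) ^ 2 / (T.rank * y)) / (4 * κ ^ 2))) ≤
      2 * μ * ((20 + 1).factorial / (g ^ 2 / (16 * κ ^ 2 * μ ^ 2)) ^ (20 + 1)) /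
        (y ^ 10 * x ^ 10) := by
    intro x y hy hyx hxy
    have hx : 0 < x := hy.trans_le hyx
    have e1 : g ^ 2 / (16 * κ ^ 2 * μ ^ 2) * x ≤
        (θ / 2) ^ 2 / (T.rank * y) / (4 * κ ^ 2) := by
      rw [div_div, div_mul_eq_mul_div, div_le_div_iff₀ (by positivity) (by positivity)]
      have e2 : (T.rank : ℝ) ^ 2 ≤ μ ^ 2 := pow_le_pow_left₀ hr'.le hrμ' 2
      calc g ^ 2 * x * (T.rank * y * (4 * κ ^ 2))
          = 4 * κ ^ 2 * T.rank * (g ^ 2 * (x * y)) := by ring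
        _ ≤ 4 * κ ^ 2 * T.rank * (T.rank * θ ^ 2) := by gcongr
        _ = 4 * κ ^ 2 * θ ^ 2 * T.rank ^ 2 := by ring
        _ ≤ 4 * κ ^ 2 * θ ^ 2 * μ ^ 2 := by gcongr
        _ = _ := by ring
    have e3 := mul_exp_neg_mul_le hh hx 20
    calc T.rank * y * (2 * Real.exp (-((θ / 2) ^ 2 / (T.rank * y)) / (4 * κ ^ 2)))
        ≤ μ * x * (2 * Real.exp (-(g ^ 2 / (16 * κ ^ 2 * μ ^ 2) * x))) := by
          gcongr
          rw [neg_div]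
          exact neg_le_neg e1
      _ = 2 * μ * (x * Real.exp (-(g ^ 2 / (16 * κ ^ 2 * μ ^ 2) * x))) := by ring
      _ ≤ 2 * μ * ((20 + 1).factorial / (g ^ 2 / (16 * κ ^ 2 * μ ^ 2)) ^ (20 + 1) / x ^ 20) := by
          gcongr
      _ ≤ 2 * μ * ((20 + 1).factorial / (g ^ 2 / (16 * κ ^ 2 * μ ^ 2)) ^ (20 + 1) /
            (y ^ 10 * x ^ 10)) := by
          gcongr
          calc y ^ 10 * x ^ 10 ≤ x ^ 10 * x ^ 10 := by gcongr
            _ = x ^ 20 := by ring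
      _ = _ := by ring
  have hι' : (0 : ℝ) < Fintype.card ι := by exact_mod_cast hι
  have hγ' : (0 : ℝ) < Fintype.card γ := by exact_mod_cast hγ
  rcases le_total (Fintype.card γ) (Fintype.card ι) with hle | hle
  · obtain ⟨bad, hbad, hgood⟩ := h.exists_measure_le_forall_mem_sum_sq_le
      (g := fun (a : ι) (b : γ) => Sum.inl (a, b)) (fun b a a' ha => by simpa using ha)
      (LinearMap.range T.toEuclideanLin) (half_pos hθ0).le
    rw [← rank_eq_finrank_range_toEuclideanLin] at hbad
    refine ⟨bad, hbad.trans (ENNReal.ofReal_le_ofReal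
      (tail _ _ hγ' (by exact_mod_cast hle) hθ)), fun ω hω => Or.inr fun x hx => ?_⟩
    refine le_of_sq_le_sq ?_ (by positivity)
    rw [euclidean_norm_sq, mul_pow]
    simp_rw [adjoint_toEuclideanLin_apply]
    exact hgood ω hω x hx
  · obtain ⟨bad, hbad, hgood⟩ := h.exists_measure_le_forall_mem_sum_sq_le
      (g := fun (b : γ) (a : ι) => Sum.inl (a, b)) (fun b a a' ha => by simpa using ha)
      (LinearMap.ker T.toEuclideanLin)ᗮ (half_pos hθ0).le
    rw [finrank_ker_orthogonal, ← rank_eq_finrank_range_toEuclideanLin] at hbad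
    have ht := tail (Fintype.card γ) (Fintype.card ι) hι' (by exact_mod_cast hle) (by rwa [mul_comm (Fintype.card γ : ℝ)])
    rw [mul_comm ((Fintype.card ι : ℝ) ^ 10)] at ht
    refine ⟨bad, hbad.trans (ENNReal.ofReal_le_ofReal ht), fun ω hω => Or.inl fun y hy => ?_⟩
    refine le_of_sq_le_sq ?_ (by positivity)
    rw [euclidean_norm_sq, mul_pow]
    simp_rw [toEuclideanLin_apply_apply]
    exact hgood ω hω y hy

end Subgroup

/-- Dictionary: A = √|MAR|, B = √|MAC|, ρ = √r, s = |MAC|^(1/4), nb = ‖β̃‖₂, ℓ = ‖β̃‖₁, lg =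
√log(|MAC||MAR|). The logarithm enters only through lg ≥ 1. -/
theorem add_le_mul_error_terms {A B g ρ θ s μ nb ℓ lg : ℝ} (hA : 1 ≤ A) (hB : 1 ≤ B)
    (hg : 0 < g) (hρ : 1 ≤ ρ) (hρμ : ρ ^ 2 ≤ μ) (hs : 0 < s) (hsB : s ^ 2 = B) (hθ : 0 < θ)
    (hgθ : g * (A * B) ≤ ρ * θ) (hnb : 0 ≤ nb) (hℓ : θ * nb ≤ B * ℓ) (hlg : 1 ≤ lg) :
    A * (A * B) * ((A + B) * nb + 1) / θ ^ 2 + A * B * nb / θ ≤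
      (2 / g ^ 3 + √μ / g ^ 2 + 1 / g ^ 2) * (ρ / s + ρ ^ 3 * ℓ * lg / min B A) := by
  have hA0 : 0 < A := by linarith
  have hB0 : 0 < B := by linarith
  have hρ0 : 0 < ρ := by linarith
  have hmin : 0 < min B A := lt_min hB0 hA0
  have hinv : A * B / θ ≤ ρ / g := by
    rw [div_le_div_iff₀ hθ hg]
    linarith
  have hinv2 : A * B * (A * B) / θ ^ 2 ≤ ρ ^ 2 / g ^ 2 := by
    calc A * B * (A * B) / θ ^ 2 = (A * B / θ) ^ 2 := by ring
      _ ≤ (ρ / g) ^ 2 := pow_le_pow_left₀ (by positivity) hinv 2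
      _ = _ := div_pow _ _ _
  -- Passing from the ℓ² to the ℓ¹ norm gains a factor `1 / A`; this absorbs the growth of the
  -- non-sharp bound on ‖Δ‖².
  have hℓA : g * A * nb ≤ ρ * ℓ := by
    refine le_of_mul_le_mul_right ?_ hB0
    calc g * A * nb * B = g * (A * B) * nb := by ring
      _ ≤ ρ * θ * nb := by gcongr
      _ = ρ * (θ * nb) := by ring
      _ ≤ ρ * (B * ℓ) := by gcongr
      _ = _ := by ring
  set e₂ := ρ ^ 3 * ℓ * lg / min B A with he₂
  have h1 : ρ ^ 2 * (g * A * nb) / min B A ≤ e₂ := by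
    rw [he₂]
    refine div_le_div_of_nonneg_right ?_ hmin.le
    calc ρ ^ 2 * (g * A * nb) ≤ ρ ^ 2 * (ρ * ℓ) := by gcongr
      _ = ρ ^ 3 * ℓ * 1 := by ring
      _ ≤ ρ ^ 3 * ℓ * lg := by
        have : 0 ≤ ℓ := by
          have : 0 ≤ ρ * ℓ := le_trans (by positivity) hℓA
          exact nonneg_of_mul_nonneg_right this hρ0
        gcongr
  have hnb2 : ρ ^ 2 * nb ≤ e₂ / g := by
    rw [le_div_iff₀ hg]
    refine le_trans ?_ h1
    rw [le_div_iff₀ hmin]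
    calc ρ ^ 2 * nb * g * min B A ≤ ρ ^ 2 * nb * g * A := by
          gcongr
          exact min_le_right _ _
      _ = _ := by ring
  have hnb3 : ρ ^ 2 * nb * (A / B) ≤ e₂ / g := by
    rw [le_div_iff₀ hg]
    refine le_trans ?_ h1
    calc ρ ^ 2 * nb * (A / B) * g = ρ ^ 2 * (g * A * nb) / B := by ring
      _ ≤ _ := by
        gcongr
        exact min_le_left _ _
  have he₂0 : 0 ≤ e₂ := le_trans (by positivity) h1
  have t1 : A * (A * B) * ((A + B) * nb) / θ ^ 2 ≤ 2 / g ^ 3 * e₂ := by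
    calc A * (A * B) * ((A + B) * nb) / θ ^ 2
        = A * B * (A * B) / θ ^ 2 * (nb * (A / B) + nb) := by field_simp
      _ ≤ ρ ^ 2 / g ^ 2 * (nb * (A / B) + nb) := by gcongr
      _ = (ρ ^ 2 * nb * (A / B) + ρ ^ 2 * nb) / g ^ 2 := by ring
      _ ≤ (e₂ / g + e₂ / g) / g ^ 2 := by gcongr
      _ = _ := by field_simp; ring
  have t2 : A * B * nb / θ ≤ 1 / g ^ 2 * e₂ := by
    calc A * B * nb / θ = A * B / θ * nb := by ring
      _ ≤ ρ / g * nb := by gcongr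
      _ ≤ ρ ^ 2 / g * nb := by
        gcongr
        nlinarith
      _ = (ρ ^ 2 * nb) / g := by ring
      _ ≤ (e₂ / g) / g := by gcongr
      _ = _ := by field_simp
  -- This term has `ρ ^ 2` while `error1` has `ρ`; the rank bound pays the extra `ρ` with `√μ`.
  -- Moreover `s ≤ B`, as `s ^ 2 = B ≥ 1`.
  have t3 : A * (A * B) / θ ^ 2 ≤ √μ / g ^ 2 * (ρ / s) := by
    have hsB' : s ≤ B := by nlinarith
    calc A * (A * B) / θ ^ 2 = A * B * (A * B) / θ ^ 2 * (1 / B) := by field_simp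
      _ ≤ ρ ^ 2 / g ^ 2 * (1 / s) := by gcongr
      _ = ρ / g ^ 2 * (ρ / s) := by ring
      _ ≤ √μ / g ^ 2 * (ρ / s) := by
        gcongr
        exact Real.le_sqrt_of_sq_le hρμ
  have p1 : 0 ≤ (2 / g ^ 3 + 1 / g ^ 2) * (ρ / s) := by positivity
  have p2 : 0 ≤ √μ / g ^ 2 * e₂ := by positivity
  calc A * (A * B) * ((A + B) * nb + 1) / θ ^ 2 + A * B * nb / θ
      = A * (A * B) * ((A + B) * nb) / θ ^ 2 + A * (A * B) / θ ^ 2 + A * B * nb / θ := by ring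
    _ ≤ 2 / g ^ 3 * e₂ + √μ / g ^ 2 * (ρ / s) + 1 / g ^ 2 * e₂ := by gcongr
    _ ≤ _ := by linarith

-- From the model assumptions to the normalised matrix problem.

theorem lintegral_exp_sq_le_two_of_psi2Norm_lt {Ω : Type*} [MeasurableSpace Ω] {P : Measure Ω} {X : Ω → ℝ}
    {s : ℝ} (hs : psi2Norm P X < ENNReal.ofReal s) :
    ∫⁻ ω, ENNReal.ofReal (Real.exp ((X ω / s) ^ 2)) ∂P ≤ 2 := by
  simp only [psi2Norm, iInf_lt_iff] at hs
  obtain ⟨t, ht, hle, hts⟩ := hs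
  have ht' : (0 : ℝ) < t := ht
  have hts' : (t : ℝ) < s := by
    rw [← ENNReal.ofReal_coe_nnreal] at hts
    exact (ENNReal.ofReal_lt_ofReal_iff_of_nonneg ht'.le).1 hts
  refine le_trans (lintegral_mono fun ω => ENNReal.ofReal_le_ofReal (Real.exp_le_exp.2 ?_)) hle
  rw [div_pow, div_pow]
  have : 0 < s := ht'.trans hts'
  gcongr

theorem IsTruncatedSVDEstimate.const_smul {ι κ : Type*} [Fintype ι] [Fintype κ]
    {S : Matrix ι κ ℝ} {q : κ → ℝ} {x : ι → ℝ} {lam : ℕ} {est : ℝ}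
    (h : IsTruncatedSVDEstimate S q x lam est) (a : ℝ) :
    IsTruncatedSVDEstimate S q (a • x) lam (a * est) := by
  obtain ⟨τ, u, v, hsvd, rfl⟩ := h
  exact ⟨τ, u, v, hsvd, by rw [smul_dotProduct, smul_eq_mul]⟩

namespace Model

variable {M : Model.{u}} {σ C : ℝ}

/-- The factor 2 makes the bound on the ψ₂ norm strict: that norm is an infimum, so parameters
strictly above it are known to be admissible. It also covers vanishing variances. -/
theorem SubgaussianNoise.isSubgaussianFamily (h : M.SubgaussianNoise σ C) (hσ : 0 < σ)
    (hC : 0 < C) (hf : ∀ d, 0 < M.f d) :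
    IsSubgaussianFamily M.P
      (fun t : Fin M.L × Fin M.m × Fin M.n => fun ω => M.noise t.1 t.2.1 t.2.2 ω / M.f t.1)
      (2 * C * σ) where
  aemeasurable t := (h.1 _ _ _).div_const _
  iIndepFun := h.2.1.comp (fun t x => x / M.f t.1) fun t => measurable_id.div_const _
  integral_eq_zero t := by rw [integral_div, h.2.2.1, zero_div]
  pos := by positivity
  lintegral_le t := by
    obtain ⟨s, hs⟩ := h.2.2.2
    obtain ⟨h0, h1, -, h2⟩ := hs t.1 t.2.1 t.2.2
    have hft := hf t.1
    simp_rw [div_div]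
    refine lintegral_exp_sq_le_two_of_psi2Norm_lt (h2.trans_lt ?_)
    rw [ENNReal.ofReal_lt_ofReal_iff (by positivity)]
    calc C * s t.1 t.2.1 t.2.2 ≤ C * (M.f t.1 * σ) := by gcongr
      _ < M.f t.1 * (2 * C * σ) := by
        have : 0 < C * (M.f t.1 * σ) := by positivity
        linarith

theorem A_eq (hL : M.LowRank) (hS : M.Selection) (d : Fin M.L) (i : Fin M.m) (j : Fin M.n) :
    M.A d i j = M.U d i ⬝ᵥ M.V d j := by
  have h1 : M.Y d i j = fun ω => M.U d i ⬝ᵥ M.V d j + M.noise d i j ω :=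
    funext fun ω => hL d i j ω
  rw [A, h1, integral_add (integrable_const _) (hS d i j).1, (hS d i j).2]
  simp

/-- By span inclusion, any μ of the rows already span all the others. -/
theorem finrank_span_rows_le {μ : ℕ} (h : M.SpanInclusion μ) (d : Fin M.L)
    {I : Finset (Fin M.m)} (hI : μ ≤ I.card) :
    Module.finrank ℝ (Submodule.span ℝ (Set.range fun a : I => M.U d a)) ≤ μ := by
  obtain ⟨J, hJI, hJ⟩ := Finset.exists_subset_card_eq hI
  have hle : Submodule.span ℝ (Set.range fun a : I => M.U d a) ≤
      Submodule.span ℝ (J.image (M.U d) : Set (Fin M.r → ℝ)) := by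
    rw [Submodule.span_le]
    rintro _ ⟨a, rfl⟩
    have hmem : ∀ a' ∈ J, M.U d a' ∈ Submodule.span ℝ (J.image (M.U d) : Set (Fin M.r → ℝ)) :=
      fun a' ha' => Submodule.subset_span (by simpa using ⟨a', ha', rfl⟩)
    by_cases ha : (a : Fin M.m) ∈ J
    · exact hmem _ ha
    · obtain ⟨β, hβ⟩ := h d a J ha hJ.ge
      show M.U d a ∈ _
      rw [show M.U d a = _ from hβ]
      exact Submodule.sum_mem _ fun a' _ => Submodule.smul_mem _ _ (hmem _ a'.2)
  refine (Submodule.finrank_mono hle).trans ((finrank_span_finset_le_card _).trans ?_)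
  exact Finset.card_image_le.trans hJ.le

end Model

namespace Subgroups

variable {M : Model.{u}} {i : Fin M.m} {j : Fin M.n} {d : Fin M.L} (G : Subgroups M i j d)

/-- The treatment level of an anchor column. -/
def level (k : Fin G.K) (b : G.MAC k) : Fin M.L :=
  (M.D i b).get (Option.isSome_iff_ne_none.2 (G.treated k b b.2))

theorem D_target_row (k : Fin G.K) (b : G.MAC k) : M.D i b = some (G.level k b) := by
  simp [level]

theorem D_anchor (k : Fin G.K) (a : G.MAR k) (b : G.MAC k) :
    M.D a b = some (G.level k b) := by
  rw [G.same_treatment k a a.2 b b.2, D_target_row]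

/-- The entries of the noise array entering the estimate on a subgroup. -/
def noiseIndex (k : Fin G.K) :
    (G.MAR k × G.MAC k) ⊕ (G.MAC k ⊕ G.MAR k) → Fin M.L × Fin M.m × Fin M.n
  | Sum.inl (a, b) => (G.level k b, a, b)
  | Sum.inr (Sum.inl b) => (G.level k b, i, b)
  | Sum.inr (Sum.inr a) => (d, a, j)

/-- The target row and column lie outside the anchors, so the three blocks of noise do not overlap
and inherit independence from the whole array. -/
theorem noiseIndex_injective (k : Fin G.K) : Function.Injective (G.noiseIndex k) := by
  have hr : ∀ a : G.MAR k, (a : Fin M.m) ≠ i := fun a =>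
    ne_of_mem_of_not_mem a.2 (G.row_notMem k)
  have hc : ∀ b : G.MAC k, (b : Fin M.n) ≠ j := fun b =>
    ne_of_mem_of_not_mem b.2 (G.col_notMem k)
  rintro (⟨a, b⟩ | b | a) (⟨a', b'⟩ | b' | a') h <;>
    simp only [noiseIndex, Prod.mk.injEq] at h
  · rw [Subtype.ext h.2.1, Subtype.ext h.2.2]
  · exact absurd h.2.1 (hr a)
  · exact absurd h.2.2 (hc b)
  · exact absurd h.2.1.symm (hr a')
  · rw [Subtype.ext h.2.2]
  · exact absurd h.2.1.symm (hr a')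
  · exact absurd h.2.2.symm (hc b')
  · exact absurd h.2.1 (hr a)
  · rw [Subtype.ext h.2.1]

/-- The noise entering the estimate on a subgroup, relative to the range of the outcomes. -/
noncomputable def relNoise (k : Fin G.K) (t : (G.MAR k × G.MAC k) ⊕ (G.MAC k ⊕ G.MAR k))
    (ω : M.Ω) : ℝ :=
  M.noise (G.noiseIndex k t).1 (G.noiseIndex k t).2.1 (G.noiseIndex k t).2.2 ω /
    M.f (G.noiseIndex k t).1

variable {w : Fin M.n → Fin M.L → ℝ}

theorem colWeight_eq (hw : ∀ b e, w b e = 1 / M.f e) (k : Fin G.K) (b : G.MAC k) :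
    G.colWeight w b = 1 / M.f (G.level k b) := by
  simp [colWeight, G.D_target_row, hw]

theorem S_apply (hw : ∀ b e, w b e = 1 / M.f e) (hL : M.LowRank) (k : Fin G.K) (ω : M.Ω)
    (a : G.MAR k) (b : G.MAC k) :
    G.S w k ω a b = 1 / M.f (G.level k b) * (M.U (G.level k b) a ⬝ᵥ M.V (G.level k b) b) +
      noiseMatrix (G.relNoise k) ω a b := by
  simp only [S, G.colWeight_eq hw, Model.obs, G.D_anchor, hL _ _ _ ω, noiseMatrix, relNoise,
    noiseIndex]
  ring

theorem ES_apply (hw : ∀ b e, w b e = 1 / M.f e) (hL : M.LowRank) (hS : M.Selection)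
    (k : Fin G.K) (a : G.MAR k) (b : G.MAC k) :
    G.ES w k a b = 1 / M.f (G.level k b) * (M.U (G.level k b) a ⬝ᵥ M.V (G.level k b) b) := by
  simp only [ES, G.S_apply hw hL, noiseMatrix, relNoise, noiseIndex]
  rw [integral_add (integrable_const _) ((hS _ _ _).1.div_const _), integral_div, (hS _ _ _).2]
  simp

theorem S_eq (hw : ∀ b e, w b e = 1 / M.f e) (hL : M.LowRank) (hS : M.Selection)
    (k : Fin G.K) (ω : M.Ω) : G.S w k ω = G.ES w k + noiseMatrix (G.relNoise k) ω := by
  ext a b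
  rw [Matrix.add_apply, G.S_apply hw hL, G.ES_apply hw hL hS]

theorem abs_ES_le (hw : ∀ b e, w b e = 1 / M.f e) (hL : M.LowRank) (hS : M.Selection)
    (hB : M.BoundedOutcomes) (k : Fin G.K) (a : G.MAR k) (b : G.MAC k) :
    |G.ES w k a b| ≤ 1 := by
  have hf := hB.1 (G.level k b)
  rw [G.ES_apply hw hL hS, ← Model.A_eq hL hS, abs_mul, abs_of_pos (by positivity), one_div,
    inv_mul_le_iff₀ hf, mul_one]
  exact hB.2 _ _ _

theorem Ex_apply (hL : M.LowRank) (hS : M.Selection) (k : Fin G.K) (a : G.MAR k) :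
    G.Ex k a = M.U d a ⬝ᵥ M.V d j := by
  simp only [Ex, x, Model.obs, G.target_treatment k a a.2]
  exact Model.A_eq hL hS d a j

theorem x_eq (hL : M.LowRank) (hS : M.Selection) (hB : M.BoundedOutcomes) (k : Fin G.K)
    (ω : M.Ω) :
    G.x k ω = M.f d • ((M.f d)⁻¹ • G.Ex k + colNoise (G.relNoise k) ω).ofLp := by
  have hf := (hB.1 d).ne'
  ext a
  simp only [x, Model.obs, G.target_treatment k a a.2, hL _ _ _ ω, Pi.smul_apply,
    WithLp.ofLp_add, WithLp.ofLp_smul, Pi.add_apply, smul_eq_mul, G.Ex_apply hL hS, colNoise,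
    relNoise, noiseIndex]
  field_simp

/-- The adjoint kills the orthogonal complement of the range, so β may be replaced by its projection
in the mean of q. -/
theorem adjoint_ES_projCoeff (k : Fin G.K) (β : EuclideanSpace ℝ (G.MAR k)) :
    LinearMap.adjoint (G.ES w k).toEuclideanLin (G.projCoeff w k β) =
      LinearMap.adjoint (G.ES w k).toEuclideanLin β := by
  refine ext_inner_right ℝ fun y => ?_
  rw [LinearMap.adjoint_inner_left, LinearMap.adjoint_inner_left, projCoeff,
    Submodule.inner_starProjection_left_eq_right,
    Submodule.starProjection_eq_self_iff.2]
  exact LinearMap.mem_range_self _ _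

theorem q_eq (hw : ∀ b e, w b e = 1 / M.f e) (hL : M.LowRank) (hS : M.Selection)
    (hsh : M.SharedRows) (k : Fin G.K) {β : EuclideanSpace ℝ (G.MAR k)}
    (hβ : M.IsCoeff d i (G.MAR k) β) (ω : M.Ω) :
    G.q w k ω = (LinearMap.adjoint (G.ES w k).toEuclideanLin (G.projCoeff w k β) +
      rowNoise (G.relNoise k) ω).ofLp := by
  ext b
  -- Shared row factors: coefficients found at level `d` serve at the level of every anchor column.
  have hU : M.U (G.level k b) i = ∑ a : G.MAR k, β a • M.U (G.level k b) a := by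
    rw [hsh (G.level k b) d i, show M.U d i = _ from hβ]
    exact Finset.sum_congr rfl fun a _ => by rw [hsh (G.level k b) d a]
  rw [adjoint_ES_projCoeff]
  simp only [q, G.colWeight_eq hw, Model.obs, G.D_target_row, hL _ _ _ ω, WithLp.ofLp_add,
    Pi.add_apply, adjoint_toEuclideanLin_apply, G.ES_apply hw hL hS, rowNoise, relNoise,
    noiseIndex]
  rw [mul_add, hU, sum_dotProduct, Finset.mul_sum]
  congr 1
  · refine Finset.sum_congr rfl fun a _ => ?_
    rw [smul_dotProduct, smul_eq_mul]
    ring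
  · ring

theorem A_target_eq (hL : M.LowRank) (hS : M.Selection) (hsub : G.SubspaceInclusion w)
    (k : Fin G.K) {β : EuclideanSpace ℝ (G.MAR k)} (hβ : M.IsCoeff d i (G.MAR k) β) :
    M.A d i j = ⟪G.Ex k, G.projCoeff w k β⟫ := by
  rw [projCoeff, ← Submodule.inner_starProjection_left_eq_right,
    Submodule.starProjection_eq_self_iff.2 (hsub k), Model.A_eq hL hS,
    show M.U d i = _ from hβ, sum_dotProduct, PiLp.inner_apply]
  refine Finset.sum_congr rfl fun a _ => ?_
  rw [smul_dotProduct, smul_eq_mul, G.Ex_apply hL hS]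
  simp

theorem rank_ES_le {μ : ℕ} (hw : ∀ b e, w b e = 1 / M.f e) (hL : M.LowRank)
    (hS : M.Selection) (hsp : M.SpanInclusion μ) (hsh : M.SharedRows) (k : Fin G.K)
    (hk : μ ≤ (G.MAR k).card) : (G.ES w k).rank ≤ μ := by
  have h1 : G.ES w k = (Matrix.of fun (a : G.MAR k) l => M.U d a l) *
      Matrix.of fun l (b : G.MAC k) => 1 / M.f (G.level k b) * M.V (G.level k b) b l := by
    ext a b
    rw [G.ES_apply hw hL hS, Matrix.mul_apply, hsh _ d a, dotProduct, Finset.mul_sum]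
    refine Finset.sum_congr rfl fun l _ => ?_
    simp only [Matrix.of_apply]
    ring
  rw [h1]
  refine (Matrix.rank_mul_le_left _ _).trans ?_
  rw [Matrix.rank_eq_finrank_span_row]
  exact Model.finrank_span_rows_le hsp d hk

theorem isSubgaussianFamily_relNoise {σ C : ℝ} (h : M.SubgaussianNoise σ C) (hσ : 0 < σ)
    (hC : 0 < C) (hB : M.BoundedOutcomes) (k : Fin G.K) :
    IsSubgaussianFamily M.P (G.relNoise k) (2 * C * σ) :=
  (h.isSubgaussianFamily hσ hC hB.1).precomp (G.noiseIndex_injective k)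

/-- A vector x = Ty with T bounded is spread out: each |x_a| is at most √|γ|‖y‖, and ‖x‖₂² ≤
max|x_a| · ‖x‖₁. -/
theorem sum_abs_lower_bound {ι γ : Type*} [Fintype ι] [Fintype γ] [DecidableEq γ]
    {T : Matrix ι γ ℝ} (hT : ∀ a b, |T a b| ≤ 1) {x : EuclideanSpace ℝ ι} {θ : ℝ}
    (hθ : 0 < θ) (hpre : ∃ y, T.toEuclideanLin y = x ∧ θ * ‖y‖ ≤ ‖x‖) :
    θ * ‖x‖ ≤ √(Fintype.card γ) * ∑ a, |x a| := by
  obtain ⟨y, hyx, hy⟩ := hpre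
  rcases (norm_nonneg x).eq_or_lt with h0 | hpos
  · rw [← h0, mul_zero]
    positivity
  have hent : ∀ a, |x a| ≤ √(Fintype.card γ) * ‖y‖ := fun a => by
    rw [← hyx, toEuclideanLin_apply_apply, euclidean_norm_eq y]
    refine Real.abs_le_sqrt ?_ |>.trans_eq (Real.sqrt_mul (by positivity) _)
    refine (Finset.sum_mul_sq_le_sq_mul_sq _ _ _).trans ?_
    gcongr
    refine (Finset.sum_le_sum fun b _ => (sq_le_one_iff_abs_le_one _).2 (hT a b)).trans ?_
    simp
  have h2 : ‖x‖ ^ 2 ≤ (√(Fintype.card γ) * ‖y‖) * ∑ a, |x a| := by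
    rw [euclidean_norm_sq, Finset.mul_sum]
    refine Finset.sum_le_sum fun a _ => ?_
    rw [← sq_abs, sq]
    exact mul_le_mul_of_nonneg_right (hent a) (abs_nonneg _)
  refine le_of_mul_le_mul_right ?_ hpos
  have h3 : 0 ≤ √(Fintype.card γ) * ∑ a, |x a| := by positivity
  calc θ * ‖x‖ * ‖x‖ = θ * ‖x‖ ^ 2 := by ring
    _ ≤ θ * ((√(Fintype.card γ) * ‖y‖) * ∑ a, |x a|) := by gcongr
    _ = √(Fintype.card γ) * (∑ a, |x a|) * (θ * ‖y‖) := by ring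
    _ ≤ _ := by gcongr

end Subgroups

-- Probabilistic bounds on each subgroup and their sum.

theorem errorBound_nonneg {Ω ι γ : Type*} [Fintype ι] [Fintype γ] [DecidableEq ι]
    [DecidableEq γ] (T : Matrix ι γ ℝ) (X : (ι × γ) ⊕ (γ ⊕ ι) → Ω → ℝ) {θ : ℝ} (hθ : 0 < θ)
    (β : EuclideanSpace ℝ ι) (ω : Ω) : 0 ≤ errorBound T X θ β ω := by
  unfold errorBound
  positivity

/-- The constant in the bound of the expected error on a subgroup. -/
noncomputable def meanConst (κ g μ : ℝ) : ℝ :=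
  8 * (1 + κ ^ 2) ^ 2 * (2 / g ^ 3 + √μ / g ^ 2 + 1 / g ^ 2)

/-- The constant in the bound of the probability of an ill-conditioned anchor matrix. -/
noncomputable def tailConst (κ g μ : ℝ) : ℝ :=
  2 * μ * ((20 + 1).factorial / (g ^ 2 / (16 * κ ^ 2 * μ ^ 2)) ^ (20 + 1))

namespace Subgroups

variable {M : Model.{u}} {i : Fin M.m} {j : Fin M.n} {d : Fin M.L} (G : Subgroups M i j d)
  {w : Fin M.n → Fin M.L → ℝ} {μ : ℕ} {σ C c c' : ℝ}

/-- The Frobenius mass is at most the rank times the largest squared singular value, and balance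
compares the largest with the smallest. -/
theorem sq_mul_card_le_rank_mul_sq (hc : 0 < c) (hc' : 0 < c') (hbal : G.WellBalanced w c c')
    (k : Fin G.K) :
    (c * √c') ^ 2 * (Fintype.card (G.MAR k) * Fintype.card (G.MAC k)) ≤
      (G.ES w k).rank *
        (G.ES w k).toEuclideanLin.singularValues ((G.ES w k).rank - 1) ^ 2 := by
  have h1 := sum_sq_le_rank_mul_singularValues_sq (G.ES w k)
  obtain ⟨h2, h3⟩ := hbal k
  rw [mul_pow, Real.sq_sqrt hc'.le, Fintype.card_coe, Fintype.card_coe]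
  have h0 := (G.ES w k).toEuclideanLin.singularValues_nonneg 0
  calc c ^ 2 * c' * ((G.MAR k).card * (G.MAC k).card)
      = c ^ 2 * (c' * ((G.MAR k).card * (G.MAC k).card)) := by ring
    _ ≤ c ^ 2 * ((G.ES w k).rank * (G.ES w k).toEuclideanLin.singularValues 0 ^ 2) := by
        exact mul_le_mul_of_nonneg_left (h3.trans h1) (sq_nonneg c)
    _ = (G.ES w k).rank * (c * (G.ES w k).toEuclideanLin.singularValues 0) ^ 2 := by ring
    _ ≤ _ := by
        gcongr
        exact h2

theorem norm_inv_smul_Ex_le (hL : M.LowRank) (hS : M.Selection) (hB : M.BoundedOutcomes)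
    (k : Fin G.K) : ‖(M.f d)⁻¹ • G.Ex k‖ ≤ √(Fintype.card (G.MAR k)) := by
  have hf := hB.1 d
  rw [euclidean_norm_eq]
  refine Real.sqrt_le_sqrt ?_
  refine (Finset.sum_le_sum (g := fun _ => (1 : ℝ)) fun a _ => ?_).trans (by simp)
  rw [sq_le_one_iff_abs_le_one, WithLp.ofLp_smul, Pi.smul_apply, smul_eq_mul, abs_mul,
    abs_of_pos (inv_pos.2 hf), inv_mul_le_iff₀ hf, mul_one, G.Ex_apply hL hS,
    ← Model.A_eq hL hS]
  exact hB.2 d a j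

/-- Strict positivity allows division by the total error in Markov's inequality. -/
theorem error_pos_of_rank_pos (k : Fin G.K) (hr : 0 < (G.ES w k).rank)
    (hcol : 0 < (G.MAC k).card) (β : EuclideanSpace ℝ (G.MAR k)) :
    0 < G.error1 w k + G.error2 w k β := by
  have hr' : (0 : ℝ) < G.rk w k := by exact_mod_cast hr
  have hcol' : (0 : ℝ) < (G.MAC k).card := by exact_mod_cast hcol
  have h1 : 0 < G.error1 w k := by
    unfold error1
    positivity
  have h2 : 0 ≤ G.error2 w k β := by
    unfold error2
    positivity
  linarith

/-- On each subgroup, the estimation error is dominated, off an event of small probability, by a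
random variable of small expectation. -/
theorem exists_error_bound (hσ : 0 < σ) (hC : 0 < C) (hc : 0 < c) (hc' : 0 < c')
    (hw : ∀ b e, w b e = 1 / M.f e) (hL : M.LowRank) (hS : M.Selection)
    (hsp : M.SpanInclusion μ) (hsh : M.SharedRows) (hB : M.BoundedOutcomes)
    (hN : M.SubgaussianNoise σ C) (hbal : G.WellBalanced w c c')
    (hsub : G.SubspaceInclusion w) (k : Fin G.K) (hk : μ ≤ (G.MAR k).card)
    (hrow : 0 < (G.MAR k).card) (hcol : 0 < (G.MAC k).card)
    (hlog : 1 ≤ Real.log (((G.MAC k).card : ℝ) * (G.MAR k).card))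
    {β : EuclideanSpace ℝ (G.MAR k)} (hβ : M.IsCoeff d i (G.MAR k) β) :
    0 < G.error1 w k + G.error2 w k β ∧ ∃ (bad : Set M.Ω) (R : M.Ω → ℝ),
      M.P bad ≤ ENNReal.ofReal (tailConst (2 * C * σ) (c * √c') μ /
        ((G.MAC k).card ^ 10 * (G.MAR k).card ^ 10)) ∧
      (∀ ω, 0 ≤ R ω) ∧ Integrable R M.P ∧
      ∫ ω, R ω ∂M.P ≤ meanConst (2 * C * σ) (c * √c') μ *
        (G.error1 w k + G.error2 w k β) ∧
      ∀ ω ∉ bad, ∀ est, IsTruncatedSVDEstimate (G.S w k ω) (G.q w k ω) (G.x k ω)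
        (G.ES w k).rank est → |est - M.A d i j| ≤ M.f d * R ω := by
  set T := G.ES w k with hTdef
  set θ := T.toEuclideanLin.singularValues (T.rank - 1) with hθdef
  set g := c * √c' with hgdef
  have hg : 0 < g := by positivity
  have hf := hB.1 d
  have hrow' : (0 : ℝ) < (G.MAR k).card := by exact_mod_cast hrow
  have hcol' : (0 : ℝ) < (G.MAC k).card := by exact_mod_cast hcol
  have hθ : g ^ 2 * (Fintype.card (G.MAR k) * Fintype.card (G.MAC k)) ≤ T.rank * θ ^ 2 :=
    G.sq_mul_card_le_rank_mul_sq hc hc' hbal k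
  -- Rank zero would contradict the lower bound on the Frobenius norm; hence the index `T.rank - 1`
  -- is that of the last non-zero singular value.
  have hr : 0 < T.rank := by
    by_contra h0
    rw [Nat.eq_zero_of_not_pos h0, Fintype.card_coe, Fintype.card_coe, Nat.cast_zero,
      zero_mul] at hθ
    exact absurd hθ (not_le.2 (by positivity))
  have hr' : (0 : ℝ) < T.rank := by exact_mod_cast hr
  have hθ0 : 0 < θ := by
    rw [hθdef, LinearMap.singularValues_pos_iff_lt_finrank_range,
      ← rank_eq_finrank_range_toEuclideanLin]
    omega
  have hrμ : T.rank ≤ μ := G.rank_ES_le hw hL hS hsp hsh k hk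
  have hT := G.abs_ES_le hw hL hS hB k
  have hX := G.isSubgaussianFamily_relNoise hN hσ hC hB k
  have hβ' : G.projCoeff w k β ∈ LinearMap.range T.toEuclideanLin :=
    Submodule.starProjection_apply_mem _ _
  have hx₀ : (M.f d)⁻¹ • G.Ex k ∈ LinearMap.range T.toEuclideanLin :=
    Submodule.smul_mem _ _ (hsub k)
  refine ⟨G.error_pos_of_rank_pos k hr hcol β, ?_⟩
  obtain ⟨bad, hbad, hgood⟩ := exists_measure_le_forall_notMem_small hX (T := T) (μ := μ) hg
    (by simpa using hrow) (by simpa using hcol) hr hrμ hθ0 hθ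
  obtain ⟨hint, hmean⟩ :=
    integrable_errorBound_and_integral_le hX hT hθ0 (G.projCoeff w k β)
  refine ⟨bad, errorBound T (G.relNoise k) θ (G.projCoeff w k β), ?_,
    errorBound_nonneg _ _ hθ0 _, hint, ?_, fun ω hω est hest => ?_⟩
  · rw [Fintype.card_coe, Fintype.card_coe] at hbad
    exact hbad
  · refine hmean.trans ?_
    have hpre := exists_preimage_singularValues_mul_norm_le _ hβ'
    rw [← rank_eq_finrank_range_toEuclideanLin] at hpre
    have hℓ := sum_abs_lower_bound hT hθ0 hpre
    rw [Fintype.card_coe, Fintype.card_coe] at hθ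
    rw [Fintype.card_coe] at hℓ
    have hρ : √(T.rank : ℝ) ^ 2 = T.rank := Real.sq_sqrt hr'.le
    have hρ3 : (T.rank : ℝ) ^ (3 / 2 : ℝ) = √(T.rank : ℝ) ^ 3 := by
      rw [Real.sqrt_eq_rpow, ← Real.rpow_natCast, ← Real.rpow_mul hr'.le]
      norm_num
    have hs : (((G.MAC k).card : ℝ) ^ (1 / 4 : ℝ)) ^ 2 = √((G.MAC k).card : ℝ) := by
      rw [Real.sqrt_eq_rpow, ← Real.rpow_natCast, ← Real.rpow_mul hcol'.le]
      norm_num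
    have hone : ∀ {x : ℕ}, 0 < x → 1 ≤ √(x : ℝ) := fun hx =>
      Real.one_le_sqrt.2 (by exact_mod_cast hx)
    have hgθ : g * (√((G.MAR k).card : ℝ) * √((G.MAC k).card : ℝ)) ≤ √(T.rank : ℝ) * θ := by
      refine le_of_sq_le_sq ?_ (by positivity)
      calc (g * (√((G.MAR k).card : ℝ) * √((G.MAC k).card : ℝ))) ^ 2
          = g ^ 2 * (√((G.MAR k).card : ℝ) ^ 2 * √((G.MAC k).card : ℝ) ^ 2) := by ring
        _ = g ^ 2 * ((G.MAR k).card * (G.MAC k).card) := by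
            rw [Real.sq_sqrt hrow'.le, Real.sq_sqrt hcol'.le]
        _ ≤ √(T.rank : ℝ) ^ 2 * θ ^ 2 := by rwa [hρ]
        _ = _ := by ring
    have hmain := add_le_mul_error_terms (μ := μ) (hone hrow) (hone hcol) hg (hone hr)
      (by rw [hρ]; exact_mod_cast hrμ) (Real.rpow_pos_of_pos hcol' (1 / 4)) hs hθ0
      hgθ (norm_nonneg (G.projCoeff w k β)) hℓ
      (Real.one_le_sqrt.2 hlog)
    rw [Fintype.card_coe, Fintype.card_coe, meanConst, mul_assoc (8 * _)]
    refine mul_le_mul_of_nonneg_left ?_ (by positivity)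
    rw [error1, error2, show G.rk w k = T.rank from rfl, hρ3]
    exact hmain
  · rw [G.S_eq hw hL hS, G.q_eq hw hL hS hsh k hβ, G.x_eq hL hS hB] at hest
    -- The estimate is linear in x, so x can be normalised by `M.f d` although the algorithm does
    -- not weight it.
    have h1 := hest.const_smul (M.f d)⁻¹
    rw [smul_smul, inv_mul_cancel₀ hf.ne', one_smul] at h1
    have h2 := abs_estimate_sub_le_errorBound hθdef hθ0 hx₀ (G.norm_inv_smul_Ex_le hL hS hB k)
      hβ' (hgood ω hω) h1
    rw [real_inner_smul_left, ← G.A_target_eq hL hS hsub k hβ, ← mul_sub, abs_mul,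
      abs_of_pos (inv_pos.2 hf), inv_mul_le_iff₀ hf] at h2
    exact h2

/-- Union bound and Markov's inequality over the subgroups. -/
theorem measure_abs_sub_gt_le (hf : 0 < M.f d) {β : ∀ k : Fin G.K, EuclideanSpace ℝ (G.MAR k)}
    {lam : Fin G.K → ℕ} {a c₀ B : ℝ} (hB : 0 < B) {bad : Fin G.K → Set M.Ω}
    {R : Fin G.K → M.Ω → ℝ} (hpos : ∀ k, 0 < G.error1 w k + G.error2 w k (β k))
    (hR : ∀ k ω, 0 ≤ R k ω) (hint : ∀ k, Integrable (R k) M.P)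
    (hmean : ∀ k, ∫ ω, R k ω ∂M.P ≤ c₀ * (G.error1 w k + G.error2 w k (β k)))
    (hest : ∀ k, ∀ ω ∉ bad k, ∀ est, IsTruncatedSVDEstimate (G.S w k ω) (G.q w k ω) (G.x k ω)
      (lam k) est → |est - a| ≤ M.f d * R k ω)
    {Ahat : M.Ω → ℝ} (hAhat : ∀ ω, G.IsMSNNEstimate w lam ω (Ahat ω)) :
    M.P {ω | B * (M.f d * G.bound w β) < |Ahat ω - a|} ≤
      ∑ k, M.P (bad k) + ENNReal.ofReal (c₀ / B) := by
  have hK : (0 : ℝ) < G.K := by exact_mod_cast G.K_pos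
  set e := ∑ k, (G.error1 w k + G.error2 w k (β k)) with he
  have hepos : 0 < e := Finset.sum_pos (fun k _ => hpos k) ⟨⟨0, G.K_pos⟩, Finset.mem_univ _⟩
  have hsub : {ω | B * (M.f d * G.bound w β) < |Ahat ω - a|} ⊆
      (⋃ k, bad k) ∪ {ω | B * e ≤ ∑ k, R k ω} := by
    intro ω hω
    by_cases hmem : ω ∈ ⋃ k, bad k
    · exact Or.inl hmem
    refine Or.inr ?_
    simp only [Set.mem_iUnion, not_exists] at hmem
    obtain ⟨est, hest', hA⟩ := hAhat ω
    have h1 : |Ahat ω - a| ≤ 1 / G.K * (M.f d * ∑ k, R k ω) := by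
      have h2 : Ahat ω - a = 1 / G.K * ∑ k, (est k - a) := by
        rw [hA, Finset.sum_sub_distrib, Finset.sum_const, Finset.card_univ, Fintype.card_fin,
          nsmul_eq_mul]
        field_simp
      rw [h2, abs_mul, abs_of_pos (by positivity), Finset.mul_sum]
      refine mul_le_mul_of_nonneg_left ?_ (by positivity)
      exact (Finset.abs_sum_le_sum_abs _ _).trans
        (Finset.sum_le_sum fun k _ => hest k ω (hmem k) _ (hest' k))
    -- The ℓ² term of the bound is non-negative and is discarded.
    have h3 : 1 / (G.K : ℝ) * e ≤ G.bound w β := by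
      unfold bound
      refine mul_le_mul_of_nonneg_left ?_ (by positivity)
      exact le_add_of_nonneg_right (Real.sqrt_nonneg _)
    have h4 : B * (M.f d * (1 / G.K * e)) ≤ 1 / G.K * (M.f d * ∑ k, R k ω) := by
      refine le_trans ?_ ((le_of_lt hω).trans h1)
      gcongr
    have h5 : M.f d * (1 / G.K) * (B * e) ≤ M.f d * (1 / G.K) * ∑ k, R k ω := by
      calc _ = B * (M.f d * (1 / G.K * e)) := by ring
        _ ≤ _ := h4
        _ = _ := by ring
    exact le_of_mul_le_mul_left h5 (by positivity)
  refine (measure_mono hsub).trans ((measure_union_le _ _).trans (add_le_add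
    (measure_iUnion_fintype_le _ _) ?_))
  have hmarkov := mul_meas_ge_le_integral_of_nonneg (μ := M.P) (f := fun ω => ∑ k, R k ω)
    (Eventually.of_forall fun ω => Finset.sum_nonneg fun k _ => hR k ω)
    (integrable_finsetSum _ fun k _ => hint k) (B * e)
  rw [integral_finsetSum _ fun k _ => hint k] at hmarkov
  have hsum : ∑ k, ∫ ω, R k ω ∂M.P ≤ c₀ * e := by
    rw [he, Finset.mul_sum]
    exact Finset.sum_le_sum fun k _ => hmean k
  rw [← ofReal_measureReal]
  refine ENNReal.ofReal_le_ofReal ?_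
  rw [le_div_iff₀ hB]
  refine le_of_mul_le_mul_right ?_ hepos
  linarith

end Subgroups

end MSNN

-- The asymptotic statement: choice of constants along the sequence.

theorem theorem4p3
    -- the universal constants of the assumptions
    (μ : ℕ) (σ C c c' : ℝ) (hσ : 0 < σ) (hC : 0 < C) (hc : 0 < c) (hc' : 0 < c')
    -- a sequence of problems, each with a target entry and level, and with subgroups of anchors
    (M : ℕ → MSNN.Model)
    (i : ∀ n, Fin (M n).m) (j : ∀ n, Fin (M n).n) (d : ∀ n, Fin (M n).L)
    (G : ∀ n, MSNN.Subgroups (M n) (i n) (j n) (d n))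
    (hMAR : ∀ n k, μ ≤ ((G n).MAR k).card)
    -- the weights `1 / f`
    (w : ∀ n, Fin (M n).n → Fin (M n).L → ℝ) (hw : ∀ n b e, w n b e = 1 / (M n).f e)
    -- the assumptions
    (hLowRank : ∀ n, (M n).LowRank)
    (hSelection : ∀ n, (M n).Selection)
    (hSpan : ∀ n, (M n).SpanInclusion μ)
    (hShared : ∀ n, (M n).SharedRows)
    (hBounded : ∀ n, (M n).BoundedOutcomes)
    (hNoise : ∀ n, (M n).SubgaussianNoise σ C)
    (hBalanced : ∀ n, (G n).WellBalanced (w n) c c')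
    (hSubspace : ∀ n, (G n).SubspaceInclusion (w n))
    -- growth of the number of subgroups
    (hK : (fun n => ((G n).K : ℝ)) =o[atTop] fun n =>
      ⨅ k, (((G n).MAC k).card : ℝ) ^ 10 * (((G n).MAR k).card : ℝ) ^ 10)
    -- coefficient vectors of row `i` with respect to the anchor rows
    (β : ∀ n (k : Fin (G n).K), EuclideanSpace ℝ ((G n).MAR k))
    (hβ : ∀ n k, (M n).IsCoeff (d n) (i n) ((G n).MAR k) (β n k))
    -- the output of the algorithm, with truncation levels `rank (E[S_w])`
    (Ahat : ∀ n, (M n).Ω → ℝ)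
    (hAhat : ∀ n ω, (G n).IsMSNNEstimate (w n) (fun k => ((G n).ES (w n) k).rank) ω (Ahat n ω)) :
    MSNN.IsBigOInProbability (fun n => (M n).P)
      (fun n ω => Ahat n ω - (M n).A (d n) (i n) (j n))
      (fun n => (M n).f (d n) * (G n).bound (w n) (β n)) := by
  intro δ hδ
  -- `δ` may be infinite; a finite positive `δ'` below it is split between the bad events and
  -- Markov's inequality.
  obtain ⟨δ', hδ'0, hδ'⟩ := ENNReal.lt_iff_exists_nnreal_btwn.1 hδ
  have hδ'0 : (0 : ℝ) < δ' := by exact_mod_cast hδ'0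
  set c₀ := MSNN.meanConst (2 * C * σ) (c * √c') μ with hc₀
  set c₁ := MSNN.tailConst (2 * C * σ) (c * √c') μ with hc₁
  have hc₀0 : 0 < c₀ := by
    rw [hc₀, MSNN.meanConst]
    positivity
  have hc₁0 : 0 ≤ c₁ := by
    rw [hc₁, MSNN.tailConst]
    positivity
  refine ⟨2 * c₀ / δ', by positivity, ?_⟩
  -- The first entry keeps the total probability of the bad events below `δ' / 2`; `c₁ + 1` is used
  -- since `c₁` vanishes for `μ = 0`. The second one, with `K ≥ 1`, forces |MAC||MAR| ≥ 3 > e, so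
  -- the anchor sets are non-empty and the logarithm is at least 1.
  set ε : ℝ := min (δ' / (2 * (c₁ + 1))) (1 / 3 ^ 10) with hε
  have hε0 : 0 < ε := lt_min (by positivity) (by positivity)
  filter_upwards [hK.bound hε0] with n hn
  have hKpos : (0 : ℝ) < (G n).K := by exact_mod_cast (G n).K_pos
  have hK1 : (1 : ℝ) ≤ (G n).K := by exact_mod_cast (G n).K_pos
  have hprod : ∀ k, ((G n).K : ℝ) ≤
      ε * ((((G n).MAC k).card : ℝ) ^ 10 * (((G n).MAR k).card : ℝ) ^ 10) := fun k => by
    rw [Real.norm_of_nonneg hKpos.le,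
      Real.norm_of_nonneg (Real.iInf_nonneg fun k => by positivity)] at hn
    exact hn.trans (mul_le_mul_of_nonneg_left (ciInf_le (Set.finite_range _).bddBelow k) hε0.le)
  have hlarge : ∀ k, (3 : ℝ) ≤ ((G n).MAC k).card * ((G n).MAR k).card := fun k => by
    have h1 : (1 : ℝ) ≤ 1 / 3 ^ 10 *
        ((((G n).MAC k).card : ℝ) ^ 10 * (((G n).MAR k).card : ℝ) ^ 10) := by
      refine hK1.trans ((hprod k).trans ?_)
      gcongr
      exact min_le_right _ _
    refine le_of_pow_le_pow_left₀ (n := 10) (by norm_num) (by positivity) ?_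
    rw [mul_pow]
    linarith
  have hcards : ∀ k, 0 < ((G n).MAR k).card ∧ 0 < ((G n).MAC k).card := fun k => by
    have h1 : 0 < ((G n).MAC k).card * ((G n).MAR k).card := by
      have : (0 : ℝ) < ((G n).MAC k).card * ((G n).MAR k).card := by linarith [hlarge k]
      exact_mod_cast this
    exact ⟨Nat.pos_of_mul_pos_left h1, Nat.pos_of_mul_pos_right h1⟩
  have hlog : ∀ k, 1 ≤ Real.log ((((G n).MAC k).card : ℝ) * ((G n).MAR k).card) := fun k => by
    rw [Real.le_log_iff_exp_le (by linarith [hlarge k])]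
    exact Real.exp_one_lt_three.le.trans (hlarge k)
  have hsub := fun k => (G n).exists_error_bound hσ hC hc hc' (hw n) (hLowRank n) (hSelection n)
    (hSpan n) (hShared n) (hBounded n) (hNoise n) (hBalanced n) (hSubspace n) k (hMAR n k)
    (hcards k).1 (hcards k).2 (hlog k) (hβ n k)
  choose hpos bad R hbad hR hint hmean hest using hsub
  refine ((G n).measure_abs_sub_gt_le ((hBounded n).1 (d n)) (by positivity) hpos hR hint hmean
    hest (hAhat n)).trans (le_trans ?_ hδ'.le)
  have hbadk : ∀ k, (M n).P (bad k) ≤ ENNReal.ofReal (δ' / 2 / (G n).K) := fun k => by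
    refine (hbad k).trans (ENNReal.ofReal_le_ofReal ?_)
    have hq : (0 : ℝ) < (((G n).MAC k).card : ℝ) ^ 10 * (((G n).MAR k).card : ℝ) ^ 10 := by
      have := (hcards k).1
      have := (hcards k).2
      positivity
    rw [div_le_div_iff₀ hq hKpos]
    calc c₁ * (G n).K
        ≤ c₁ * (ε * ((((G n).MAC k).card : ℝ) ^ 10 * (((G n).MAR k).card : ℝ) ^ 10)) := by
          gcongr
          exact hprod k
      _ = c₁ * ε * ((((G n).MAC k).card : ℝ) ^ 10 * (((G n).MAR k).card : ℝ) ^ 10) := by ring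
      _ ≤ δ' / 2 * ((((G n).MAC k).card : ℝ) ^ 10 * (((G n).MAR k).card : ℝ) ^ 10) := by
          gcongr
          calc c₁ * ε ≤ (c₁ + 1) * (δ' / (2 * (c₁ + 1))) := by
                gcongr
                · linarith
                · exact min_le_left _ _
            _ = δ' / 2 := by field_simp
  calc ∑ k, (M n).P (bad k) + ENNReal.ofReal (c₀ / (2 * c₀ / δ'))
      ≤ ∑ _k : Fin (G n).K, ENNReal.ofReal (δ' / 2 / (G n).K) +
          ENNReal.ofReal (c₀ / (2 * c₀ / δ')) := by
        gcongr with k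
        exact hbadk k
    _ = ENNReal.ofReal (δ' / 2) + ENNReal.ofReal (δ' / 2) := by
        congr 1
        · rw [Finset.sum_const, Finset.card_univ, Fintype.card_fin, nsmul_eq_mul,
            ← ENNReal.ofReal_natCast, ← ENNReal.ofReal_mul hKpos.le]
          congr 1
          field_simp
        · congr 1
          field_simp
    _ = δ' := by
        rw [← ENNReal.ofReal_add (by positivity) (by positivity), add_halves,
          ENNReal.ofReal_coe_nnreal]
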